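/- **Theorem (Algorithm optimality).** Consider an asynchronous message-passing system of $n$ processes $p_1,\dots,p_n$ in which up to $t$ processes are Byzantine (arbitrary, colluding); the other ones are called correct, and $c\ge n-t$ denotes their number in an execution. Correct processes send implementation messages by an unreliable operation $\mathsf{broadcast}$, which sends one copy to each of the $n$ processes; for each such broadcast a message adversary may suppress up to $d$ of the copies intended to correct processes, and every other copy intended to a correct process is eventually received. Signatures are ideal: nobody can produce a signature of a correct process that this process has not issued. An algorithm is *event-driven* if its correct processes send implementation messages only when the operation $\mathsf{mbrb\_broadcast}$ is invoked or when an implementation message is received. An algorithm *implements MBRB* for $\langle t,d\rangle$ if the following holds in all executions in which no correct process uses the same sequence number twice. - *Validity:* if a correct process mbrb-delivers $(m,sn,j)$, i.e. $m$ with sequence number $sn$ from $p_j$, and $p_j$ is correct, then $p_j$ mbrb-broadcast $(m,sn)$. - *No-duplication:* a correct process mbrb-delivers at most one application message, at most once, for given $(sn,j)$. - *No-duplicity:* two different correct processes never mbrb-deliver different application messages for the same $(sn,j)$. - *Local-delivery:* if a correct $p_i$ mbrb-broadcasts $(m,sn)$, then some correct process eventually mbrb-delivers $(m,sn,i)$.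 - *Global-delivery:* if a correct process mbrb-delivers $(m,sn,j)$, then at least $c-d$ correct processes eventually do. Let $\mathcal A_{n,t}$ be the following signature-based algorithm (code for $p_i$). On $\mathsf{mbrb\_broadcast}(m,sn)$: save one's own signature for $(m,sn,i)$, and broadcast $\mathrm{BUNDLE}(m,sn,i,S)$, where $S$ is the set of all saved signatures for $(m,sn,i)$. On reception of $\mathrm{BUNDLE}(m,sn,j,S')$: if no $(-,sn,j)$ has been mbrb-delivered yet and $S'$ contains a valid signature for $(m,sn,j)$ by $p_j$, then (1) save the valid signatures for $(m,sn,j)$ in $S'$; (2) if no $(-,sn,j)$ has been signed by $p_i$ yet, save one's own signature for $(m,sn,j)$ and broadcast $\mathrm{BUNDLE}(m,sn,j,\text{all saved signatures for }(m,sn,j))$; (3) if strictly more than $\frac{n+t}{2}$ signatures for $(m,sn,j)$ are saved, broadcast $\mathrm{BUNDLE}(m,sn,j,\text{all saved signatures for }(m,sn,j))$ and mbrb-deliver $(m,sn,j)$. Then the following holds. 1. (Sufficiency.) If $n>3t+2d$, then $\mathcal A_{n,t}$, which is event-driven, implements MBRB for $\langle t,d\rangle$. 2. (Necessity and optimality.)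 Let $t\ge 1$, $n\ge 3$ and $d<n-t$, and let there be at least two application messages. If some event-driven algorithm, signature-free or signature-based, implements MBRB for $\langle t,d\rangle$, then $n>3t+2d$, and therefore $\mathcal A_{n,t}$ implements MBRB for $\langle t,d\rangle$ as well: $\mathcal A_{n,t}$ is optimal with respect to the pair $\langle t,d\rangle$. -/

import Mathlib

universe u v

namespace MBRB

/-! ### Algorithms -/

/-- An application message together with its identity: `(m, sn, j)` is the application message `m`
with sequence number `sn` and sender `p_j`. -/
abbrev Tagged (n : ℕ) (App : Type u) : Type u := App × ℕ × Fin n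

/-- What a process reacts to: the invocation `mbrb_broadcast(m, sn)` by its application, the
reception of an implementation message (with the identity of the process it comes from, which an
algorithm for unauthenticated channels just ignores), or a spontaneous local step. -/
inductive Input (n : ℕ) (App : Type u) (Msg : Type v) : Type (max u v)
  | invoke (m : App) (sn : ℕ)
  | receive (src : Fin n) (msg : Msg)
  | tick

/-- A (deterministic) algorithm for `n` processes.  `step i s x` is what `p_i` does in the local
state `s` on input `x`: its new local state, the list of implementation messages that it passes to
the unreliable operation `broadcast`, and the list of `(m, sn, j)` that it mbrb-delivers.

Signatures are ideal: a signature is a pair (signer, signed data), and `sigs msg` is the set of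
signatures that occur in the implementation message `msg`.  A signature-free algorithm has
`sigs msg = ∅` for every `msg`. -/
structure Algorithm (n : ℕ) (App : Type u) where
  State : Type v
  Msg : Type v
  Data : Type v
  sigs : Msg → Set (Fin n × Data)
  init : Fin n → State
  step : Fin n → State → Input n App Msg → State × List Msg × List (Tagged n App)

namespace Algorithm

variable {n : ℕ} {App : Type u} (A : Algorithm.{u, v} n App)

/-- The local state of `p_i` after a sequence of inputs. -/
def run (i : Fin n) (h : List (Input n App A.Msg)) : A.State :=
  h.foldl (fun s x => (A.step i s x).1) (A.init i)

/-- Only invocations of `mbrb_broadcast` and receptions of implementation messages generate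
the sending of implementation messages. -/
def EventDriven : Prop :=
  ∀ (i : Fin n) (h : List (Input n App A.Msg)), (A.step i (A.run i h) Input.tick).2.1 = []

/-- A process following the algorithm does not forge signatures: every signature in a message
that `p_i` broadcasts is one by `p_i` itself, or it occurs in a message that `p_i` has received. -/
def NonForging : Prop :=
  ∀ (i : Fin n) (h : List (Input n App A.Msg)) (x : Input n App A.Msg),
    ∀ msg ∈ (A.step i (A.run i h) x).2.1, ∀ σ ∈ A.sigs msg,
      σ.1 = i ∨ ∃ src msg', Input.receive src msg' ∈ h ++ [x] ∧ σ ∈ A.sigs msg'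

end Algorithm

/-! ### Executions -/

/-- The data of an execution, observed at the correct processes.

* `byz` is the set of Byzantine processes.
* `event k = some (i, x)` means that at time `k` the correct process `p_i` handles the input `x`;
  `event k = none` means that no correct process takes a step at time `k`.
* `state k i` is the local state of `p_i` before the event of time `k`.
* A broadcast message is identified by the time `k` of the step that broadcast it and its position
  `r` in the list of messages broadcast in that step.  `lost k r` is the set of correct processes
  whose copy of it is suppressed by the message adversary.
* If the event of time `k` is the reception of a message from a correct process, `origin k`
  identifies the message of which a copy is received. -/
structure Trace {n : ℕ} {App : Type u} (A : Algorithm.{u, v} n App) where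
  byz : Finset (Fin n)
  event : ℕ → Option (Fin n × Input n App A.Msg)
  state : ℕ → Fin n → A.State
  lost : ℕ → ℕ → Finset (Fin n)
  origin : ℕ → ℕ × ℕ

namespace Trace

variable {n : ℕ} {App : Type u} {A : Algorithm.{u, v} n App} (E : Trace A)

/-- The set of correct processes of the execution; its cardinality is usually written `c`. -/
def correct : Finset (Fin n) := E.byzᶜ

/-- The implementation messages broadcast (by the acting correct process) at time `k`. -/
def sent (k : ℕ) : List A.Msg :=
  match E.event k with
  | none => []
  | some (i, x) => (A.step i (E.state k i) x).2.1

/-- What the acting correct process mbrb-delivers at time `k`. -/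
def delivered (k : ℕ) : List (Tagged n App) :=
  match E.event k with
  | none => []
  | some (i, x) => (A.step i (E.state k i) x).2.2

/-- `p_i` is the (correct) process that takes a step at time `k`. -/
def ActsAt (i : Fin n) (k : ℕ) : Prop := ∃ x, E.event k = some (i, x)

/-- The correct process `p_i` mbrb-broadcasts `(m, sn)`. -/
def Broadcasts (i : Fin n) (m : App) (sn : ℕ) : Prop :=
  ∃ k, E.event k = some (i, Input.invoke m sn)

/-- The correct process `p_i` mbrb-delivers `(m, sn, j)`. -/
def Delivers (i : Fin n) (m : App) (sn : ℕ) (j : Fin n) : Prop :=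
  ∃ k, E.ActsAt i k ∧ (m, sn, j) ∈ E.delivered k

/-- The rules of the asynchronous system with at most `t` Byzantine processes and a message
adversary of power `d`. -/
structure IsExecution (t d : ℕ) : Prop where
  /-- At most `t` processes are Byzantine. -/
  byz_card : E.byz.card ≤ t
  /-- The events are those of correct processes, which follow the algorithm. -/
  event_correct : ∀ k i, E.ActsAt i k → i ∈ E.correct
  state_zero : ∀ i, E.state 0 i = A.init i
  state_succ_acts : ∀ k i x, E.event k = some (i, x) →
    E.state (k + 1) i = (A.step i (E.state k i) x).1
  state_succ_other : ∀ k i, ¬ E.ActsAt i k → E.state (k + 1) i = E.state k i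
  /-- A correct process does not use the same sequence number twice. -/
  invoke_once : ∀ i m m' sn k k', E.event k = some (i, Input.invoke m sn) →
    E.event k' = some (i, Input.invoke m' sn) → k = k'
  /-- The message adversary suppresses at most `d` copies of each message broadcast by a
  correct process, among those intended to correct processes. -/
  lost_correct : ∀ k r, E.lost k r ⊆ E.correct
  lost_card : ∀ k r, (E.lost k r).card ≤ d
  /-- The network neither creates nor corrupts messages: what is received from a correct process
  has been broadcast by it before, and the received copy has not been suppressed. -/
  receive_correct : ∀ k i j msg, E.event k = some (i, Input.receive j msg) → j ∈ E.correct →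
    (E.origin k).1 < k ∧ E.ActsAt j (E.origin k).1 ∧
      (E.sent (E.origin k).1)[(E.origin k).2]? = some msg ∧
      i ∉ E.lost (E.origin k).1 (E.origin k).2
  /-- The network does not duplicate messages. -/
  receive_once : ∀ k k' i j j' msg msg', E.event k = some (i, Input.receive j msg) →
    E.event k' = some (i, Input.receive j' msg') → j ∈ E.correct → j' ∈ E.correct →
    E.origin k = E.origin k' → k = k'
  /-- Byzantine processes may send anything to anyone at any time and they share all they know,
  but signatures are secure: a signature by a correct process in a message from a Byzantine
  process must have occurred before in a message broadcast by a correct process. -/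
  receive_byz : ∀ k i j msg, E.event k = some (i, Input.receive j msg) → j ∈ E.byz →
    ∀ σ ∈ A.sigs msg, σ.1 ∈ E.correct → ∃ k' < k, ∃ msg' ∈ E.sent k', σ ∈ A.sigs msg'

/-- Every copy, intended to a correct process, of a message broadcast by a correct process is
eventually received unless the message adversary suppresses it; every correct process takes local
steps forever. -/
structure Fair : Prop where
  receives : ∀ k r j, E.ActsAt j k → r < (E.sent k).length → ∀ i ∈ E.correct, i ∉ E.lost k r →
    ∃ k' msg, E.event k' = some (i, Input.receive j msg) ∧ E.origin k' = (k, r)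
  ticks : ∀ i ∈ E.correct, ∀ k, ∃ k' ≥ k, E.event k' = some (i, Input.tick)

/-! ### The MBRB specification -/

/-- MBRB-Validity (no spurious message). -/
def Validity : Prop :=
  ∀ i ∈ E.correct, ∀ j ∈ E.correct, ∀ m sn, E.Delivers i m sn j → E.Broadcasts j m sn

/-- MBRB-No-duplication: a correct process performs at most one mbrb-delivery for a given sender
and a given sequence number. -/
def NoDuplication : Prop :=
  ∀ i ∈ E.correct, ∀ (j : Fin n) (sn k k' r r' : ℕ) (m m' : App), E.ActsAt i k → E.ActsAt i k' →
    (E.delivered k)[r]? = some (m, sn, j) → (E.delivered k')[r']? = some (m', sn, j) →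
    k = k' ∧ r = r'

/-- MBRB-No-duplicity. -/
def NoDuplicity : Prop :=
  ∀ i ∈ E.correct, ∀ i' ∈ E.correct, i ≠ i' → ∀ j sn m m',
    E.Delivers i m sn j → E.Delivers i' m' sn j → m = m'

/-- MBRB-Local-delivery. -/
def LocalDelivery : Prop :=
  ∀ i ∈ E.correct, ∀ m sn, E.Broadcasts i m sn → ∃ j ∈ E.correct, E.Delivers j m sn i

/-- MBRB-Global-delivery: if a correct process mbrb-delivers `(m, sn, j)`, then at least `l`
correct processes do. -/
def GlobalDelivery (l : ℕ) : Prop :=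
  ∀ i ∈ E.correct, ∀ m sn j, E.Delivers i m sn j →
    l ≤ {i' : Fin n | i' ∈ E.correct ∧ E.Delivers i' m sn j}.ncard

end Trace

/-- The algorithm implements MBRB, with at most `t` Byzantine processes and a message adversary of
power `d`, with the delivery guarantee `c - d`, where `c` is the number of correct processes of the
execution: the safety properties hold at every moment of every execution (no matter which messages
are still in transit), the liveness properties hold in every fair execution. -/
def Algorithm.ImplementsMBRB {n : ℕ} {App : Type u} (A : Algorithm.{u, v} n App) (t d : ℕ) : Prop :=
  ∀ E : Trace A, E.IsExecution t d →
    (E.Validity ∧ E.NoDuplication ∧ E.NoDuplicity) ∧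
    (E.Fair → E.LocalDelivery ∧ E.GlobalDelivery (E.correct.card - d))

/-! ### The signature-based algorithm -/

/-- A signature: its signer and the signed triple `(m, sn, j)`. -/
abbrev Signature (n : ℕ) (App : Type u) : Type u := Fin n × Tagged n App

/-- The implementation message `BUNDLE(m, sn, j, sigs)`. -/
structure Bundle (n : ℕ) (App : Type u) : Type u where
  content : Tagged n App
  sigs : Finset (Signature n App)

/-- The local variables of a process: the signatures it has saved, and the pairs `(sn, j)` for
which it has signed, respectively mbrb-delivered, some `(-, sn, j)`. -/
structure SBState (n : ℕ) (App : Type u) : Type u where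
  saved : Finset (Signature n App)
  signed : Finset (ℕ × Fin n)
  delivered : Finset (ℕ × Fin n)

namespace SBState

variable {n : ℕ} {App : Type u} [DecidableEq App]

/-- All saved signatures for the triple `a`. -/
def savedFor (s : SBState n App) (a : Tagged n App) : Finset (Signature n App) :=
  s.saved.filter (fun σ => σ.2 = a)

/-- `BUNDLE(a, {all saved signatures for a})`. -/
def bundle (s : SBState n App) (a : Tagged n App) : Bundle n App := ⟨a, s.savedFor a⟩

/-- Save the signature for the triple `a` by `p_i` (the process running this code). -/
def sign (s : SBState n App) (i : Fin n) (a : Tagged n App) : SBState n App :=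
  { s with saved := insert (i, a) s.saved, signed := insert a.2 s.signed }

/-- Save the signatures for the triple `a` that occur in `sigs`. -/
def save (s : SBState n App) (a : Tagged n App) (sigs : Finset (Signature n App)) :
    SBState n App :=
  { s with saved := s.saved ∪ sigs.filter (fun σ => σ.2 = a) }

end SBState

/-- Operation `mbrb_broadcast(m, sn)`, code for `p_i`. -/
def sbInvoke {n : ℕ} {App : Type u} [DecidableEq App] (i : Fin n) (s : SBState n App)
    (m : App) (sn : ℕ) : SBState n App × List (Bundle n App) × List (Tagged n App) :=
  let s' := s.sign i (m, sn, i)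
  (s', [s'.bundle (m, sn, i)], [])

/-- When `BUNDLE(a, sigs)` is received, where `a = (m, sn, j)`, code for `p_i`. -/
def sbReceive {n : ℕ} {App : Type u} [DecidableEq App] (t : ℕ) (i : Fin n) (s : SBState n App)
    (b : Bundle n App) : SBState n App × List (Bundle n App) × List (Tagged n App) :=
  let a := b.content
  if a.2 ∉ s.delivered ∧ (a.2.2, a) ∈ b.sigs then
    let s₁ := s.save a b.sigs
    let s₂ := if a.2 ∉ s₁.signed then s₁.sign i a else s₁
    let forward := if a.2 ∉ s₁.signed then [s₂.bundle a] else []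
    -- strictly more than `(n + t) / 2` signatures for `a` are saved
    if n + t < 2 * (s₂.savedFor a).card then
      ({ s₂ with delivered := insert a.2 s₂.delivered }, forward ++ [s₂.bundle a], [a])
    else (s₂, forward, [])
  else (s, [], [])

/-- The signature-based MBRB algorithm with parameters `n` and `t`. -/
def sbAlgorithm (n : ℕ) (App : Type u) [DecidableEq App] (t : ℕ) : Algorithm.{u, u} n App where
  State := SBState n App
  Msg := Bundle n App
  Data := Tagged n App
  sigs := fun b => {σ | σ ∈ b.sigs}
  init := fun _ => ⟨∅, ∅, ∅⟩
  step := fun i s x =>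
    match x with
    | .invoke m sn => sbInvoke i s m sn
    | .receive _ b => sbReceive t i s b
    | .tick => (s, [], [])

end MBRB

namespace MBRB

/-! ### One step of the signature-based algorithm -/

section Step

variable {n : ℕ} {App : Type u} [DecidableEq App]

/-! Sufficiency rests on two facts about correct processes: a saved signature of such a process was
issued by it (`unforgeable`), and it never signs two messages for the same `(sn, j)`
(`own_saved_unique`). Two sets of more than `(n + t) / 2` signers share more than `t` processes,
hence a correct one, so all deliveries for `(sn, j)` agree (`delivers_unique`). For global delivery,
the bundle broadcast on delivery contains a full quorum and reaches at least `c - d` correct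
processes; each of them delivers on reception or has delivered already. For local delivery, suppose
that nobody delivers and let `R` be the set of correct signers of the triple. Each member of `R` has
broadcast its signature together with that of the sender, and the at least `c - d` correct processes
reached are in `R` as well. By double counting, some member of `R` receives signatures of at least
`c - d` members, and `2 (c - d) ≥ 2 (n - t - d) > n + t` makes it deliver, a contradiction
(`sb_localDelivery`).

Necessity is a partition argument. If `n ≤ 3t + 2d`, the processes split into `B`, `Q₀`, `Q₁` of
size at most `t` and `D₀`, `D₁` of size at most `d`, with the sender in `B`. In the execution `E b`
the sender broadcasts `m b`, the processes of `B ∪ Q_b ∪ D_b` communicate faithfully, those of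
`Q_{1-b}` are Byzantine and silent, and those of `D_{1-b}` are correct but all copies sent to them
are suppressed (`scheduledTrace`). An event-driven algorithm sends nothing from a cut-off process,
so side `b` hears nothing from the other side. Validity prevents cut-off processes from delivering,
and counting then yields a delivery of `m b` in `Q_b ∪ D_b` (`exists_delivers_notMem`). Now let `B`
be Byzantine and play its part of `E false` towards one side and that of `E true` towards the other,
while messages between the sides stay in transit (`interleave`). No signature of a correct process
has to be forged, because those that `B` uses towards a side were issued on that side
(`signature_origin`). Both messages are delivered by correct processes, against no-duplicity
(`false_of_partition`). -/

lemma SBState.mem_savedFor {s : SBState n App} {a : Tagged n App} {σ : Signature n App} :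
    σ ∈ s.savedFor a ↔ σ ∈ s.saved ∧ σ.2 = a := by
  simp [SBState.savedFor]

lemma SBState.savedFor_subset (s : SBState n App) (a : Tagged n App) : s.savedFor a ⊆ s.saved :=
  Finset.filter_subset _ _

lemma SBState.savedFor_update (s : SBState n App) (D : Finset (ℕ × Fin n)) (a : Tagged n App) :
    SBState.savedFor { s with delivered := D } a = s.savedFor a := rfl

lemma SBState.bundle_update (s : SBState n App) (D : Finset (ℕ × Fin n)) (a : Tagged n App) :
    SBState.bundle { s with delivered := D } a = s.bundle a := rfl

variable (t : ℕ) (i : Fin n) (s : SBState n App) (b : Bundle n App)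

/-- The effect of a reception, split into the cases of the code. -/
lemma sbReceive_cases :
    (¬ (b.content.2 ∉ s.delivered ∧ (b.content.2.2, b.content) ∈ b.sigs) ∧
      sbReceive t i s b = (s, [], [])) ∨
    (b.content.2 ∉ s.delivered ∧ (b.content.2.2, b.content) ∈ b.sigs ∧
      ∃ (s₂ : SBState n App) (fwd : List (Bundle n App)), s₂.delivered = s.delivered ∧
        ((b.content.2 ∉ s.signed ∧ fwd = [s₂.bundle b.content] ∧
            s₂.signed = insert b.content.2 s.signed ∧
            s₂.saved = insert (i, b.content) (s.saved ∪ b.sigs.filter (fun σ => σ.2 = b.content))) ∨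
          (b.content.2 ∈ s.signed ∧ fwd = [] ∧ s₂.signed = s.signed ∧
            s₂.saved = s.saved ∪ b.sigs.filter (fun σ => σ.2 = b.content))) ∧
        ((n + t < 2 * (s₂.savedFor b.content).card ∧ sbReceive t i s b =
            ({ s₂ with delivered := insert b.content.2 s₂.delivered },
              fwd ++ [s₂.bundle b.content], [b.content])) ∨
          (¬ n + t < 2 * (s₂.savedFor b.content).card ∧ sbReceive t i s b = (s₂, fwd, [])))) := by
  by_cases h : b.content.2 ∉ s.delivered ∧ (b.content.2.2, b.content) ∈ b.sigs
  · refine .inr ⟨h.1, h.2, ?_⟩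
    by_cases h1 : b.content.2 ∈ s.signed
    · refine ⟨s.save b.content b.sigs, [], rfl, .inr ⟨h1, rfl, rfl, rfl⟩, ?_⟩
      have h1' : ¬ b.content.2 ∉ (s.save b.content b.sigs).signed := not_not.2 h1
      by_cases h2 : n + t < 2 * ((s.save b.content b.sigs).savedFor b.content).card
      · exact .inl ⟨h2, by simp only [sbReceive, if_pos h, if_neg h1', if_pos h2]⟩
      · exact .inr ⟨h2, by simp only [sbReceive, if_pos h, if_neg h1', if_neg h2]⟩
    · refine ⟨(s.save b.content b.sigs).sign i b.content, _, rfl, .inl ⟨h1, rfl, rfl, rfl⟩, ?_⟩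
      have h1' : b.content.2 ∉ (s.save b.content b.sigs).signed := h1
      by_cases h2 : n + t <
          2 * (((s.save b.content b.sigs).sign i b.content).savedFor b.content).card
      · exact .inl ⟨h2, by simp only [sbReceive, if_pos h, if_pos h1', if_pos h2]⟩
      · exact .inr ⟨h2, by simp only [sbReceive, if_pos h, if_pos h1', if_neg h2]⟩
  · exact .inl ⟨h, by simp only [sbReceive, if_neg h]⟩

lemma saved_subset_sbReceive : s.saved ⊆ (sbReceive t i s b).1.saved := by
  obtain ⟨hc, e⟩ | ⟨hu, hw, s₂, fwd, hd, ⟨hs, hf, hs', hv⟩ | ⟨hs, hf, hs', hv⟩, ⟨hq, e⟩ | ⟨hq, e⟩⟩ :=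
    sbReceive_cases t i s b <;>
  simp only [e] <;> grind

lemma signed_subset_sbReceive : s.signed ⊆ (sbReceive t i s b).1.signed := by
  obtain ⟨hc, e⟩ | ⟨hu, hw, s₂, fwd, hd, ⟨hs, hf, hs', hv⟩ | ⟨hs, hf, hs', hv⟩, ⟨hq, e⟩ | ⟨hq, e⟩⟩ :=
    sbReceive_cases t i s b <;>
  simp only [e] <;> grind

lemma delivered_subset_sbReceive : s.delivered ⊆ (sbReceive t i s b).1.delivered := by
  obtain ⟨hc, e⟩ | ⟨hu, hw, s₂, fwd, hd, ⟨hs, hf, hs', hv⟩ | ⟨hs, hf, hs', hv⟩, ⟨hq, e⟩ | ⟨hq, e⟩⟩ :=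
    sbReceive_cases t i s b <;>
  simp only [e] <;> grind

variable {t i s b}

lemma mem_saved_sbReceive {σ : Signature n App} (h : σ ∈ (sbReceive t i s b).1.saved) :
    σ ∈ s.saved ∨ σ ∈ b.sigs ∨
      (σ = (i, b.content) ∧ b.content.2 ∉ s.signed ∧ (b.content.2.2, b.content) ∈ b.sigs) := by
  obtain ⟨hc, e⟩ | ⟨hu, hw, s₂, fwd, hd, ⟨hs, hf, hs', hv⟩ | ⟨hs, hf, hs', hv⟩, ⟨hq, e⟩ | ⟨hq, e⟩⟩ :=
    sbReceive_cases t i s b <;>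
  simp only [e] at * <;> grind

lemma mem_signed_sbReceive {x : ℕ × Fin n} (h : x ∈ (sbReceive t i s b).1.signed) :
    x ∈ s.signed ∨ (x = b.content.2 ∧ (i, b.content) ∈ (sbReceive t i s b).1.saved ∧
      (b.content.2.2, b.content) ∈ (sbReceive t i s b).1.saved) := by
  obtain ⟨hc, e⟩ | ⟨hu, hw, s₂, fwd, hd, ⟨hs, hf, hs', hv⟩ | ⟨hs, hf, hs', hv⟩, ⟨hq, e⟩ | ⟨hq, e⟩⟩ :=
    sbReceive_cases t i s b <;>
  simp only [e] at * <;> grind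

lemma mem_sent_sbReceive {b' : Bundle n App} (h : b' ∈ (sbReceive t i s b).2.1) :
    b' = (sbReceive t i s b).1.bundle b.content := by
  obtain ⟨hc, e⟩ | ⟨hu, hw, s₂, fwd, hd, ⟨hs, hf, hs', hv⟩ | ⟨hs, hf, hs', hv⟩, ⟨hq, e⟩ | ⟨hq, e⟩⟩ :=
    sbReceive_cases t i s b <;>
  simp only [e, SBState.savedFor_update, SBState.bundle_update] at * <;> grind

lemma mem_deliver_sbReceive {a : Tagged n App} (h : a ∈ (sbReceive t i s b).2.2) :
    (sbReceive t i s b).2.2 = [a] ∧ a.2 ∉ s.delivered ∧ a.2 ∈ (sbReceive t i s b).1.delivered ∧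
      (a.2.2, a) ∈ (sbReceive t i s b).1.saved ∧
      n + t < 2 * ((sbReceive t i s b).1.savedFor a).card ∧
      (sbReceive t i s b).1.bundle a ∈ (sbReceive t i s b).2.1 := by
  obtain ⟨hc, e⟩ | ⟨hu, hw, s₂, fwd, hd, ⟨hs, hf, hs', hv⟩ | ⟨hs, hf, hs', hv⟩, ⟨hq, e⟩ | ⟨hq, e⟩⟩ :=
    sbReceive_cases t i s b <;>
  simp only [e, SBState.savedFor_update, SBState.bundle_update] at * <;> grind

lemma mem_delivered_sbReceive {x : ℕ × Fin n} (h : x ∈ (sbReceive t i s b).1.delivered) :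
    x ∈ s.delivered ∨ (x = b.content.2 ∧ b.content ∈ (sbReceive t i s b).2.2) := by
  obtain ⟨hc, e⟩ | ⟨hu, hw, s₂, fwd, hd, ⟨hs, hf, hs', hv⟩ | ⟨hs, hf, hs', hv⟩, ⟨hq, e⟩ | ⟨hq, e⟩⟩ :=
    sbReceive_cases t i s b <;>
  simp only [e] at * <;> grind

/-- What an accepted bundle forces; this drives both liveness properties. -/
lemma sbReceive_progress (h1 : b.content.2 ∉ s.delivered)
    (h2 : (b.content.2.2, b.content) ∈ b.sigs) :
    (∀ σ ∈ b.sigs, σ.2 = b.content → σ ∈ (sbReceive t i s b).1.saved) ∧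
    b.content.2 ∈ (sbReceive t i s b).1.signed ∧
    (b.content.2 ∉ s.signed → (sbReceive t i s b).1.bundle b.content ∈ (sbReceive t i s b).2.1) ∧
    (n + t < 2 * ((sbReceive t i s b).1.savedFor b.content).card →
      b.content ∈ (sbReceive t i s b).2.2) := by
  obtain ⟨hc, e⟩ | ⟨hu, hw, s₂, fwd, hd, ⟨hs, hf, hs', hv⟩ | ⟨hs, hf, hs', hv⟩, ⟨hq, e⟩ | ⟨hq, e⟩⟩ :=
    sbReceive_cases t i s b <;>
  simp only [e, SBState.savedFor_update, SBState.bundle_update] at * <;> grind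

/-- A new signature by `p_i` itself is forwarded at once. -/
lemma new_signature_sbReceive {a : Tagged n App} (h : (i, a) ∈ (sbReceive t i s b).1.saved)
    (h1 : (i, a) ∉ s.saved) (h2 : (i, a) ∉ b.sigs) :
    a = b.content ∧ (a.2.2, a) ∈ b.sigs ∧ (a.2.2, a) ∈ (sbReceive t i s b).1.saved ∧
      (sbReceive t i s b).1.bundle a ∈ (sbReceive t i s b).2.1 := by
  obtain ⟨hc, e⟩ | ⟨hu, hw, s₂, fwd, hd, ⟨hs, hf, hs', hv⟩ | ⟨hs, hf, hs', hv⟩, ⟨hq, e⟩ | ⟨hq, e⟩⟩ :=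
    sbReceive_cases t i s b <;>
  simp only [e, SBState.savedFor_update, SBState.bundle_update] at * <;> grind

end Step

/-! ### Event-drivenness and absence of forging. -/

theorem sbAlgorithm_eventDriven (n : ℕ) (App : Type u) [DecidableEq App] (t : ℕ) :
    (sbAlgorithm n App t).EventDriven :=
  fun _ _ => rfl

section Run

variable {n : ℕ} {App : Type u} [DecidableEq App] {t : ℕ}

lemma saved_sbStep {i : Fin n} {s : SBState n App} {x : Input n App (Bundle n App)}
    {σ : Signature n App} (h : σ ∈ ((sbAlgorithm n App t).step i s x).1.saved) :
    σ ∈ s.saved ∨ σ.1 = i ∨ ∃ src b, x = .receive src b ∧ σ ∈ b.sigs := by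
  cases x with
  | invoke m sn =>
    rcases Finset.mem_insert.1 (show σ ∈ insert (i, (m, sn, i)) s.saved from h) with rfl | h
    · exact .inr (.inl rfl)
    · exact .inl h
  | receive src b =>
    rcases mem_saved_sbReceive (show σ ∈ (sbReceive t i s b).1.saved from h) with h | h | h
    · exact .inl h
    · exact .inr (.inr ⟨src, b, rfl, h⟩)
    · exact .inr (.inl (by rw [h.1]))
  | tick => exact .inl h

lemma sent_sbStep {i : Fin n} {s : SBState n App} {x : Input n App (Bundle n App)}
    {b : Bundle n App} (h : b ∈ ((sbAlgorithm n App t).step i s x).2.1) :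
    b.sigs ⊆ ((sbAlgorithm n App t).step i s x).1.saved := by
  cases x with
  | invoke m sn =>
    rw [List.mem_singleton.1 (show b ∈ [(s.sign i (m, sn, i)).bundle (m, sn, i)] from h)]
    exact SBState.savedFor_subset _ _
  | receive src b' =>
    rw [mem_sent_sbReceive (show b ∈ (sbReceive t i s b').2.1 from h)]
    exact SBState.savedFor_subset _ _
  | tick => exact absurd (show b ∈ [] from h) (by simp)

/-- Bundles are drawn from the saved signatures, so it suffices to trace these along a run. -/
theorem sbAlgorithm_nonForging (n : ℕ) (App : Type u) [DecidableEq App] (t : ℕ) :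
    (sbAlgorithm n App t).NonForging := by
  have key : ∀ (i : Fin n) (h : List (Input n App (Bundle n App))) (σ : Signature n App),
      σ ∈ SBState.saved ((sbAlgorithm n App t).run i h) →
      σ.1 = i ∨ ∃ src b, Input.receive src b ∈ h ∧ σ ∈ b.sigs := by
    intro i h
    induction h using List.reverseRecOn with
    | nil => intro σ hσ; exact absurd (show σ ∈ (∅ : Finset _) from hσ) (by simp)
    | append_singleton l x ih =>
      intro σ hσ
      have e : (sbAlgorithm n App t).run i (l ++ [x]) =
          ((sbAlgorithm n App t).step i ((sbAlgorithm n App t).run i l) x).1 :=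
        List.foldl_concat (f := fun s x => ((sbAlgorithm n App t).step i s x).1) ..
      rw [e] at hσ
      rcases saved_sbStep hσ with h | h | ⟨src, b, rfl, h⟩
      · rcases ih σ h with h | ⟨src, b, h1, h2⟩
        · exact .inl h
        · exact .inr ⟨src, b, by simp [h1], h2⟩
      · exact .inl h
      · exact .inr ⟨src, b, by simp, h⟩
  intro i h x b hb σ hσ
  have := sent_sbStep hb hσ
  refine key i (h ++ [x]) σ ?_
  have e : (sbAlgorithm n App t).run i (h ++ [x]) =
      ((sbAlgorithm n App t).step i ((sbAlgorithm n App t).run i h) x).1 :=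
    List.foldl_concat (f := fun s x => ((sbAlgorithm n App t).step i s x).1) ..
  rw [e]
  exact this

end Run

/-! ### Executions of the signature-based algorithm -/

namespace Trace

lemma mem_correct {n : ℕ} {App : Type u} {A : Algorithm.{u, v} n App} {E : Trace A} {i : Fin n} :
    i ∈ E.correct ↔ i ∉ E.byz := by
  simp [correct]

variable {n : ℕ} {App : Type u} [DecidableEq App] {t d : ℕ} {E : Trace (sbAlgorithm n App t)}

/-- The local state of `p_i` at time `k`. -/
def sb (E : Trace (sbAlgorithm n App t)) (k : ℕ) (i : Fin n) : SBState n App := E.state k i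

/-- The bundles broadcast at time `k`. -/
def sbSent (E : Trace (sbAlgorithm n App t)) (k : ℕ) : List (Bundle n App) := E.sent k

lemma invoke_spec (hE : E.IsExecution t d) {k : ℕ} {i : Fin n} {m : App} {sn : ℕ}
    (h : E.event k = some (i, .invoke m sn)) :
    E.sb (k + 1) i = (E.sb k i).sign i (m, sn, i) ∧
      E.sbSent k = [((E.sb k i).sign i (m, sn, i)).bundle (m, sn, i)] ∧ E.delivered k = [] :=
  ⟨hE.state_succ_acts _ _ _ h, by simp only [sbSent, sent, h]; rfl, by simp only [delivered, h]; rfl⟩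

lemma receive_spec (hE : E.IsExecution t d) {k : ℕ} {i j : Fin n} {b : Bundle n App}
    (h : E.event k = some (i, .receive j b)) :
    E.sb (k + 1) i = (sbReceive t i (E.sb k i) b).1 ∧
      E.sbSent k = (sbReceive t i (E.sb k i) b).2.1 ∧
      E.delivered k = (sbReceive t i (E.sb k i) b).2.2 :=
  ⟨hE.state_succ_acts _ _ _ h, by simp only [sbSent, sent, h]; rfl, by simp only [delivered, h]; rfl⟩

/-- The invariants below are inductions on time over these three cases; a local step changes
nothing. -/
lemma sb_succ_cases (hE : E.IsExecution t d) (k : ℕ) (i : Fin n) :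
    E.sb (k + 1) i = E.sb k i ∨
    (∃ m sn, E.event k = some (i, .invoke m sn) ∧
      E.sb (k + 1) i = (E.sb k i).sign i (m, sn, i)) ∨
    (∃ (j : Fin n) (b : Bundle n App), E.event k = some (i, .receive j b) ∧
      E.sb (k + 1) i = (sbReceive t i (E.sb k i) b).1) := by
  by_cases h : E.ActsAt i k
  · obtain ⟨x, hx⟩ := h
    cases x with
    | invoke m sn => exact .inr (.inl ⟨m, sn, hx, (invoke_spec hE hx).1⟩)
    | receive j b => exact .inr (.inr ⟨j, b, hx, (receive_spec hE hx).1⟩)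
    | tick => exact .inl (hE.state_succ_acts _ _ _ hx)
  · exact .inl (hE.state_succ_other _ _ h)

lemma sb_mono (hE : E.IsExecution t d) {k k' : ℕ} (h : k ≤ k') (i : Fin n) :
    (E.sb k i).saved ⊆ (E.sb k' i).saved ∧ (E.sb k i).signed ⊆ (E.sb k' i).signed ∧
      (E.sb k i).delivered ⊆ (E.sb k' i).delivered := by
  induction h with
  | refl => exact ⟨subset_rfl, subset_rfl, subset_rfl⟩
  | @step k' _ ih =>
    have step : (E.sb k' i).saved ⊆ (E.sb (k' + 1) i).saved ∧
        (E.sb k' i).signed ⊆ (E.sb (k' + 1) i).signed ∧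
        (E.sb k' i).delivered ⊆ (E.sb (k' + 1) i).delivered := by
      rcases sb_succ_cases hE k' i with e | ⟨m, sn, -, e⟩ | ⟨j, b, -, e⟩ <;> rw [e]
      · exact ⟨subset_rfl, subset_rfl, subset_rfl⟩
      · exact ⟨Finset.subset_insert _ _, Finset.subset_insert _ _, subset_rfl⟩
      · exact ⟨saved_subset_sbReceive .., signed_subset_sbReceive ..,
          delivered_subset_sbReceive ..⟩
    exact ⟨ih.1.trans step.1, ih.2.1.trans step.2.1, ih.2.2.trans step.2.2⟩

/-! ### Provenance and uniqueness of the signatures of correct processes. -/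

lemma sigs_subset_of_mem_sent (hE : E.IsExecution t d) {k : ℕ} {b : Bundle n App}
    (h : b ∈ E.sbSent k) : ∃ i, E.ActsAt i k ∧ b.sigs ⊆ (E.sb (k + 1) i).saved := by
  rcases e : E.event k with _ | ⟨i, x⟩
  · have e' : E.sbSent k = [] := by simp only [sbSent, sent, e]; rfl
    simp [e'] at h
  · refine ⟨i, ⟨x, e⟩, ?_⟩
    have e' : E.sbSent k = ((sbAlgorithm n App t).step i (E.state k i) x).2.1 := by
      simp only [sbSent, sent, e]; rfl
    have := sent_sbStep (e' ▸ h)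
    rwa [← hE.state_succ_acts k i x e] at this

/-- For a correct source this is the integrity of the network, for a Byzantine source the security
of signatures. -/
lemma exists_sent_of_received (hE : E.IsExecution t d) {k : ℕ} {i j : Fin n} {b : Bundle n App}
    (h : E.event k = some (i, .receive j b)) {σ : Signature n App} (hσ : σ ∈ b.sigs)
    (hc : σ.1 ∈ E.correct) : ∃ k' < k, ∃ b' ∈ E.sbSent k', σ ∈ b'.sigs := by
  by_cases hj : j ∈ E.correct
  · obtain ⟨h1, -, h3, -⟩ := hE.receive_correct k i j b h hj
    exact ⟨_, h1, b, List.mem_of_getElem? h3, hσ⟩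
  · exact hE.receive_byz k i j b h (by simpa [mem_correct] using hj) σ hσ hc

/-- Signatures of correct processes are issued by them. -/
lemma unforgeable (hE : E.IsExecution t d) {k : ℕ} {i : Fin n} {σ : Signature n App}
    (h : σ ∈ (E.sb k i).saved) (hc : σ.1 ∈ E.correct) : σ ∈ (E.sb k σ.1).saved := by
  -- Strong induction, because a received signature is traced back to an arbitrary earlier
  -- broadcast.
  induction k using Nat.strong_induction_on generalizing i with
  | _ k ih =>
    cases k with
    | zero =>
      have : E.sb 0 i = ⟨∅, ∅, ∅⟩ := hE.state_zero i
      simp [this] at h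
    | succ k =>
      have old : ∀ {i}, σ ∈ (E.sb k i).saved → σ ∈ (E.sb (k + 1) σ.1).saved := fun h =>
        (sb_mono hE k.le_succ _).1 (ih k k.lt_succ_self h)
      rcases sb_succ_cases hE k i with e | ⟨m, sn, -, e⟩ | ⟨j, b, hb, e⟩
      · exact old (e ▸ h)
      · have h' := h
        rw [e] at h'
        rcases Finset.mem_insert.1 h' with rfl | h'
        · exact h
        · exact old h'
      · have h' := h
        rw [e] at h'
        rcases mem_saved_sbReceive h' with h' | h' | ⟨rfl, -⟩
        · exact old h'
        · obtain ⟨k', hk', b', hb', hσ⟩ := exists_sent_of_received hE hb h' hc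
          obtain ⟨i', -, hi'⟩ := sigs_subset_of_mem_sent hE hb'
          exact (sb_mono hE (by omega) _).1 (ih (k' + 1) (by omega) (hi' hσ))
        · exact h

/-- The signer holds the signature already before the reception, at time `k` and not only `k + 1`.
Hence no correct process acquires a signature of its own from a bundle. -/
lemma unforgeable_received (hE : E.IsExecution t d) {k : ℕ} {i j : Fin n} {b : Bundle n App}
    (h : E.event k = some (i, .receive j b)) {σ : Signature n App} (hσ : σ ∈ b.sigs)
    (hc : σ.1 ∈ E.correct) : σ ∈ (E.sb k σ.1).saved := by
  obtain ⟨k', hk', b', hb', hσ⟩ := exists_sent_of_received hE h hσ hc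
  obtain ⟨i', -, hi'⟩ := sigs_subset_of_mem_sent hE hb'
  exact (sb_mono hE hk' _).1 (unforgeable hE (hi' hσ) hc)

/-- A correct process signs a triple of its own only when the triple is mbrb-broadcast. -/
lemma invoked_of_own_saved (hE : E.IsExecution t d) {k : ℕ} {p : Fin n} (hp : p ∈ E.correct)
    {m : App} {sn : ℕ} (h : (p, (m, sn, p)) ∈ (E.sb k p).saved) :
    ∃ k' < k, E.event k' = some (p, .invoke m sn) := by
  induction k with
  | zero =>
    have : E.sb 0 p = ⟨∅, ∅, ∅⟩ := hE.state_zero p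
    simp [this] at h
  | succ k ih =>
    have old : (p, (m, sn, p)) ∈ (E.sb k p).saved →
        ∃ k' < k + 1, E.event k' = some (p, .invoke m sn) := fun h => by
      obtain ⟨k', hk, e⟩ := ih h
      exact ⟨k', by omega, e⟩
    rcases sb_succ_cases hE k p with e | ⟨m', sn', hx, e⟩ | ⟨j, b, hb, e⟩ <;> rw [e] at h
    · exact old h
    · rcases Finset.mem_insert.1 h with h | h
      · simp only [Prod.mk.injEq, true_and, and_true] at h
        obtain ⟨rfl, rfl⟩ := h
        exact ⟨k, k.lt_succ_self, hx⟩
      · exact old h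
    · rcases mem_saved_sbReceive h with h | h | ⟨h, -, h'⟩
      · exact old h
      · exact old (unforgeable_received hE hb h hp)
      -- Signing on reception requires the signature of the triple's sender, here `p` itself, which
      -- therefore had saved it before.
      · have e' : (m, sn, p) = b.content := (Prod.ext_iff.1 h).2
        rw [← e'] at h'
        exact old (unforgeable_received hE hb h' hp)

lemma signed_of_own_saved (hE : E.IsExecution t d) {k : ℕ} {p : Fin n} (hp : p ∈ E.correct)
    {a : Tagged n App} (h : (p, a) ∈ (E.sb k p).saved) : a.2 ∈ (E.sb k p).signed := by
  induction k with
  | zero =>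
    have : E.sb 0 p = ⟨∅, ∅, ∅⟩ := hE.state_zero p
    simp [this] at h
  | succ k ih =>
    have old : (p, a) ∈ (E.sb k p).saved → a.2 ∈ (E.sb (k + 1) p).signed := fun h =>
      (sb_mono hE k.le_succ _).2.1 (ih h)
    rcases sb_succ_cases hE k p with e | ⟨m', sn', hx, e⟩ | ⟨j, b, hb, e⟩ <;> rw [e] at h
    · exact old h
    · rcases Finset.mem_insert.1 h with h | h
      · obtain rfl : a = (m', sn', p) := (Prod.ext_iff.1 h).2
        rw [e]
        exact Finset.mem_insert_self _ _
      · exact old h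
    · by_cases h1 : (p, a) ∈ (E.sb k p).saved
      · exact old h1
      by_cases h2 : (p, a) ∈ b.sigs
      · exact old (unforgeable_received hE hb h2 hp)
      obtain ⟨rfl, h3, -⟩ := new_signature_sbReceive h h1 h2
      rw [e]
      by_cases h4 : b.content.2 ∈ (E.sb k p).delivered
      · exfalso
        have : sbReceive t p (E.sb k p) b = (E.sb k p, [], []) := by
          simp only [sbReceive]
          rw [if_neg (by simp [h4])]
        rw [this] at h
        exact h1 h
      · exact (sbReceive_progress h4 h3).2.1

/-- Whoever has signed for `(sn, j)` has saved its own signature and that of `p_j`. -/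
lemma saved_of_signed (hE : E.IsExecution t d) {k : ℕ} {p : Fin n} {x : ℕ × Fin n}
    (h : x ∈ (E.sb k p).signed) :
    ∃ m, (p, (m, x)) ∈ (E.sb k p).saved ∧ (x.2, (m, x)) ∈ (E.sb k p).saved := by
  induction k with
  | zero =>
    have : E.sb 0 p = ⟨∅, ∅, ∅⟩ := hE.state_zero p
    simp [this] at h
  | succ k ih =>
    have old : x ∈ (E.sb k p).signed → ∃ m, (p, (m, x)) ∈ (E.sb (k + 1) p).saved ∧
        (x.2, (m, x)) ∈ (E.sb (k + 1) p).saved := fun h => by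
      obtain ⟨m, h1, h2⟩ := ih h
      exact ⟨m, (sb_mono hE k.le_succ _).1 h1, (sb_mono hE k.le_succ _).1 h2⟩
    rcases sb_succ_cases hE k p with e | ⟨m', sn', hx, e⟩ | ⟨j, b, hb, e⟩ <;> rw [e] at h
    · exact old h
    · rcases Finset.mem_insert.1 h with rfl | h
      · refine ⟨m', ?_, ?_⟩ <;> rw [e] <;> exact Finset.mem_insert_self _ _
      · exact old h
    · rcases mem_signed_sbReceive h with h | ⟨rfl, h1, h2⟩
      · exact old h
      · exact ⟨b.content.1, e ▸ h1, e ▸ h2⟩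

/-- A correct process does not sign two different messages for the same `(sn, j)`. -/
lemma own_saved_unique (hE : E.IsExecution t d) {k : ℕ} {p : Fin n} (hp : p ∈ E.correct)
    {x : ℕ × Fin n} {m m' : App} (h : (p, (m, x)) ∈ (E.sb k p).saved)
    (h' : (p, (m', x)) ∈ (E.sb k p).saved) : m = m' := by
  induction k with
  | zero =>
    have : E.sb 0 p = ⟨∅, ∅, ∅⟩ := hE.state_zero p
    simp [this] at h
  | succ k ih =>
    rcases sb_succ_cases hE k p with e | ⟨m₀, sn, hx, e⟩ | ⟨j, b, hb, e⟩ <;> rw [e] at h h'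
    · exact ih h h'
    -- An earlier signature of `p` for its own `sn` would come from an earlier invocation with the
    -- same sequence number.
    · have key : ∀ m₁, (p, (m₁, sn, p)) ∉ (E.sb k p).saved := fun m₁ h => by
        obtain ⟨k', hk', e'⟩ := invoked_of_own_saved hE hp h
        exact absurd (hE.invoke_once _ _ _ _ _ _ e' hx) hk'.ne
      rcases Finset.mem_insert.1 h with h | h <;> rcases Finset.mem_insert.1 h' with h' | h'
      · simp_all
      · simp only [Prod.mk.injEq, true_and] at h
        obtain ⟨-, rfl⟩ := h
        exact absurd h' (key _)
      · simp only [Prod.mk.injEq, true_and] at h'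
        obtain ⟨-, rfl⟩ := h'
        exact absurd h (key _)
      · exact ih h h'
    -- A signature new at this step requires that nothing was signed for `x` before, which excludes
    -- the mixed cases.
    · have key : ∀ m₁, (p, (m₁, x)) ∈ (sbReceive t p (E.sb k p) b).1.saved →
          (p, (m₁, x)) ∈ (E.sb k p).saved ∨ ((m₁, x) = b.content ∧ x ∉ (E.sb k p).signed) := by
        intro m₁ h
        rcases mem_saved_sbReceive h with h | h | ⟨h, h', -⟩
        · exact .inl h
        · exact .inl (unforgeable_received hE hb h hp)
        · have := (Prod.ext_iff.1 h).2
          simp only at this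
          exact .inr ⟨this, by rw [← this] at h'; exact h'⟩
      rcases key _ h with h | h <;> rcases key _ h' with h' | h'
      · exact ih h h'
      · exact absurd (signed_of_own_saved hE hp h) h'.2
      · exact absurd (signed_of_own_saved hE hp h') h.2
      · exact (Prod.ext_iff.1 (h.1.trans h'.1.symm)).1

lemma own_saved_unique' (hE : E.IsExecution t d) {k k' : ℕ} {p : Fin n} (hp : p ∈ E.correct)
    {x : ℕ × Fin n} {m m' : App} (h : (p, (m, x)) ∈ (E.sb k p).saved)
    (h' : (p, (m', x)) ∈ (E.sb k' p).saved) : m = m' :=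
  own_saved_unique hE hp ((sb_mono hE (le_max_left k k') _).1 h)
    ((sb_mono hE (le_max_right k k') _).1 h')

/-! ### Deliveries and the safety properties. -/

/-- What holds when `p_i` mbrb-delivers `a`. -/
lemma delivered_spec (hE : E.IsExecution t d) {k : ℕ} {i : Fin n} {a : Tagged n App}
    (hi : E.ActsAt i k) (h : a ∈ E.delivered k) :
    E.delivered k = [a] ∧ a.2 ∉ (E.sb k i).delivered ∧ a.2 ∈ (E.sb (k + 1) i).delivered ∧
      (a.2.2, a) ∈ (E.sb (k + 1) i).saved ∧
      n + t < 2 * ((E.sb (k + 1) i).savedFor a).card ∧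
      (E.sb (k + 1) i).bundle a ∈ E.sbSent k := by
  obtain ⟨x, hx⟩ := hi
  cases x with
  | invoke m sn =>
    rw [(invoke_spec hE hx).2.2] at h
    simp at h
  | receive j b =>
    obtain ⟨e1, e2, e3⟩ := receive_spec hE hx
    rw [e3] at h
    rw [e1, e2, e3]
    exact mem_deliver_sbReceive h
  | tick =>
    have : E.delivered k = [] := by simp only [delivered, hx]; rfl
    rw [this] at h
    simp at h

lemma delivers_of_mem_delivered (hE : E.IsExecution t d) {k : ℕ} {i : Fin n} {x : ℕ × Fin n}
    (h : x ∈ (E.sb k i).delivered) : ∃ m, E.Delivers i m x.1 x.2 := by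
  induction k with
  | zero =>
    have : E.sb 0 i = ⟨∅, ∅, ∅⟩ := hE.state_zero i
    simp [this] at h
  | succ k ih =>
    rcases sb_succ_cases hE k i with e | ⟨m', sn', hx, e⟩ | ⟨j, b, hb, e⟩ <;> rw [e] at h
    · exact ih h
    · exact ih h
    · rcases mem_delivered_sbReceive h with h | ⟨rfl, h'⟩
      · exact ih h
      · exact ⟨b.content.1, k, ⟨_, hb⟩, by rw [(receive_spec hE hb).2.2]; exact h'⟩

theorem sb_validity (hE : E.IsExecution t d) : E.Validity := by
  rintro i - j hj m sn ⟨k, hk, h⟩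
  obtain ⟨-, -, -, h, -⟩ := delivered_spec hE hk h
  obtain ⟨k', -, h⟩ := invoked_of_own_saved hE hj (unforgeable hE h hj)
  exact ⟨k', h⟩

theorem sb_noDuplication (hE : E.IsExecution t d) : E.NoDuplication := by
  intro i _ j sn k k' r r' m m' hk hk' h h'
  have hm := delivered_spec hE hk (List.mem_of_getElem? h)
  have hm' := delivered_spec hE hk' (List.mem_of_getElem? h')
  have e : k = k' := by
    rcases lt_trichotomy k k' with hlt | rfl | hlt
    · exact absurd ((sb_mono hE hlt _).2.2 hm.2.2.1) hm'.2.1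
    · rfl
    · exact absurd ((sb_mono hE hlt _).2.2 hm'.2.2.1) hm.2.1
  refine ⟨e, ?_⟩
  rw [hm.1] at h
  rw [hm'.1] at h'
  have h1 := (List.getElem?_eq_some_iff.1 h).1
  have h2 := (List.getElem?_eq_some_iff.1 h').1
  simp at h1 h2
  omega

/-- Two mbrb-deliveries for the same `(sn, j)` by correct processes agree. -/
lemma delivers_unique (hE : E.IsExecution t d) {i i' j : Fin n} {sn : ℕ} {m m' : App}
    (h : E.Delivers i m sn j) (h' : E.Delivers i' m' sn j) : m = m' := by
  obtain ⟨k, hk, h⟩ := h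
  obtain ⟨k', hk', h'⟩ := h'
  have hq := (delivered_spec hE hk h).2.2.2.2.1
  have hq' := (delivered_spec hE hk' h').2.2.2.2.1
  -- Among the signatures for a fixed triple, a signature is determined by its signer, so quorums
  -- may be counted as sets of processes.
  have card_eq : ∀ (s : SBState n App) (a : Tagged n App),
      ((s.savedFor a).image Prod.fst).card = (s.savedFor a).card := fun s a =>
    Finset.card_image_of_injOn fun σ hσ τ hτ e =>
      Prod.ext e ((SBState.mem_savedFor.1 hσ).2.trans (SBState.mem_savedFor.1 hτ).2.symm)
  rw [← card_eq] at hq hq'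
  set Q := ((E.sb (k + 1) i).savedFor (m, sn, j)).image Prod.fst with hQ
  set Q' := ((E.sb (k' + 1) i').savedFor (m', sn, j)).image Prod.fst with hQ'
  have h1 := Finset.card_union_add_card_inter Q Q'
  have h2 : (Q ∪ Q').card ≤ n := by simpa using Finset.card_le_univ (Q ∪ Q')
  -- The sizes of the two quorums add up to more than `n + t`, and their union has at most `n`
  -- elements.
  have h3 : E.byz.card < (Q ∩ Q').card := by have := hE.byz_card; omega
  obtain ⟨p, hp, hpb⟩ := Finset.exists_mem_notMem_of_card_lt_card h3
  have hpc : p ∈ E.correct := mem_correct.2 hpb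
  have own : ∀ {k i m}, p ∈ ((E.sb (k + 1) i).savedFor (m, sn, j)).image Prod.fst →
      (p, (m, sn, j)) ∈ (E.sb (k + 1) p).saved := by
    intro k i m hp
    obtain ⟨⟨p', a⟩, hσ, rfl⟩ := Finset.mem_image.1 hp
    obtain ⟨hσ, rfl⟩ := SBState.mem_savedFor.1 hσ
    exact unforgeable hE hσ hpc
  exact own_saved_unique' hE hpc (own (Finset.mem_inter.1 hp).1) (own (Finset.mem_inter.1 hp).2)

/-! ### The liveness properties. -/

/-- The correct processes that eventually receive a broadcast message. -/
lemma card_sub_le_card_sdiff_lost (hE : E.IsExecution t d) (k r : ℕ) :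
    E.correct.card - d ≤ (E.correct \ E.lost k r).card := by
  have := Finset.le_card_sdiff (E.lost k r) E.correct
  have := hE.lost_card k r
  omega

lemma received_of_sent (hE : E.IsExecution t d) (hF : E.Fair) {k : ℕ} {p : Fin n}
    (hp : E.ActsAt p k) {b : Bundle n App} (hb : b ∈ E.sbSent k) :
    ∃ r, ∀ q ∈ E.correct \ E.lost k r, ∃ k', E.event k' = some (q, .receive p b) := by
  obtain ⟨r, hr, e⟩ := List.getElem_of_mem hb
  refine ⟨r, fun q hq => ?_⟩
  obtain ⟨hq, hl⟩ := Finset.mem_sdiff.1 hq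
  obtain ⟨k', b', h1, h2⟩ := hF.receives k r p hp hr q hq hl
  refine ⟨k', ?_⟩
  obtain ⟨-, -, h3, -⟩ := hE.receive_correct k' q p b' h1 (hE.event_correct k p hp)
  rw [h2] at h3
  have h4 : (E.sbSent k)[r]? = some b' := h3
  rw [List.getElem?_eq_getElem hr, e] at h4
  rw [h1, Option.some.inj h4]

theorem sb_globalDelivery (hE : E.IsExecution t d) (hF : E.Fair) :
    E.GlobalDelivery (E.correct.card - d) := by
  rintro i - m sn j hdel
  obtain ⟨k, hk, h⟩ := hdel
  obtain ⟨-, -, -, hj, hq, hs⟩ := delivered_spec hE hk h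
  obtain ⟨r, hr⟩ := received_of_sent hE hF hk hs
  refine (card_sub_le_card_sdiff_lost hE k r).trans ?_
  rw [← Set.ncard_coe_finset]
  refine Set.ncard_le_ncard (fun q hq' => ?_) (Set.toFinite _)
  have hq' : q ∈ E.correct \ E.lost k r := hq'
  refine ⟨(Finset.mem_sdiff.1 hq').1, ?_⟩
  obtain ⟨k', e⟩ := hr q hq'
  -- A process that ignores the quorum bundle has already delivered for `(sn, j)`, and by agreement
  -- it delivered `m`.
  by_cases hd : (sn, j) ∈ (E.sb k' q).delivered
  · obtain ⟨m', hm'⟩ := delivers_of_mem_delivered hE hd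
    rwa [delivers_unique hE ⟨k, hk, h⟩ hm']
  · refine ⟨k', ⟨_, e⟩, ?_⟩
    rw [(receive_spec hE e).2.2]
    have prog := sbReceive_progress (t := t) (i := q) (s := E.sb k' q)
      (b := (E.sb (k + 1) i).bundle (m, sn, j)) hd (SBState.mem_savedFor.2 ⟨hj, rfl⟩)
    refine prog.2.2.2 (hq.trans_le (Nat.mul_le_mul_left 2 (Finset.card_le_card fun σ hσ => ?_)))
    exact SBState.mem_savedFor.2 ⟨prog.1 σ hσ (SBState.mem_savedFor.1 hσ).2,
      (SBState.mem_savedFor.1 hσ).2⟩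

/-- A correct process broadcasts its signatures, with that of the sender of the triple. -/
lemma own_saved_sent (hE : E.IsExecution t d) {k : ℕ} {p : Fin n} (hp : p ∈ E.correct)
    {a : Tagged n App} (h : (p, a) ∈ (E.sb k p).saved) :
    ∃ k', E.ActsAt p k' ∧ ∃ b ∈ E.sbSent k', b.content = a ∧ (p, a) ∈ b.sigs ∧
      (a.2.2, a) ∈ b.sigs := by
  induction k with
  | zero =>
    have : E.sb 0 p = ⟨∅, ∅, ∅⟩ := hE.state_zero p
    simp [this] at h
  | succ k ih =>
    have h0 := h
    rcases sb_succ_cases hE k p with e | ⟨m', sn', hx, e⟩ | ⟨j, b, hb, e⟩ <;> rw [e] at h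
    · exact ih h
    · rcases Finset.mem_insert.1 h with h' | h'
      · obtain rfl := (Prod.ext_iff.1 h').2
        refine ⟨k, ⟨_, hx⟩, _, by rw [(invoke_spec hE hx).2.1]; exact List.mem_singleton_self _,
          rfl, ?_, ?_⟩ <;> exact SBState.mem_savedFor.2 ⟨h, rfl⟩
      · exact ih h'
    · by_cases h1 : (p, a) ∈ (E.sb k p).saved
      · exact ih h1
      by_cases h2 : (p, a) ∈ b.sigs
      · exact ih (unforgeable_received hE hb h2 hp)
      obtain ⟨-, -, h3, h4⟩ := new_signature_sbReceive h h1 h2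
      exact ⟨k, ⟨_, hb⟩, _, by rw [(receive_spec hE hb).2.1]; exact h4, rfl,
        SBState.mem_savedFor.2 ⟨h, rfl⟩, SBState.mem_savedFor.2 ⟨h3, rfl⟩⟩

/-- If every member of a nonempty finite set is related to at least `l` of its members, then some
member has at least `l` related members. -/
lemma exists_le_card_of_forall_le_card {α : Type*} (R : Finset α) (hR : R.Nonempty)
    (rel : α → α → Prop) [DecidableRel rel] (l : ℕ)
    (h : ∀ p ∈ R, l ≤ (R.filter fun q => rel p q).card) :
    ∃ q ∈ R, l ≤ (R.filter fun p => rel p q).card := by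
  -- Count the related pairs by first and by second component.
  have e := Finset.sum_card_bipartiteAbove_eq_sum_card_bipartiteBelow (s := R) (t := R) rel
  refine Finset.exists_le_of_sum_le hR ?_
  calc ∑ _p ∈ R, l ≤ ∑ p ∈ R, (R.bipartiteAbove rel p).card := Finset.sum_le_sum h
    _ = _ := e

theorem sb_localDelivery (hn : 3 * t + 2 * d < n) (hE : E.IsExecution t d) (hF : E.Fair) :
    E.LocalDelivery := by
  classical
  intro i hi m sn ⟨k₀, hk₀⟩
  by_contra! hno
  have uniq : ∀ {k m'}, (i, (m', sn, i)) ∈ (E.sb k i).saved → m' = m := by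
    intro k m' h
    obtain ⟨k', -, e⟩ := invoked_of_own_saved hE hi h
    have := hE.invoke_once _ _ _ _ _ _ e hk₀
    subst this
    rw [hk₀] at e
    simpa using e.symm
  -- A delivery for `(sn, i)` could only be one of `m`. Under the assumption to be refuted there is
  -- none, so no correct process ever stops accepting bundles for the triple.
  have fresh : ∀ q ∈ E.correct, ∀ k, (sn, i) ∉ (E.sb k q).delivered := by
    intro q hq k h
    obtain ⟨m', h⟩ := delivers_of_mem_delivered hE h
    obtain ⟨k', hk', h'⟩ := id h
    have := uniq (unforgeable hE (delivered_spec hE hk' h').2.2.2.1 hi)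
    exact hno q hq (this ▸ h)
  -- `rel p q`: the signature of `p` reaches `q` in a bundle that also has the sender's signature,
  -- so that `q` accepts it.
  let rel : Fin n → Fin n → Prop := fun p q => ∃ (k : ℕ) (j : Fin n) (b : Bundle n App),
    E.event k = some (q, .receive j b) ∧ b.content = (m, sn, i) ∧ (p, (m, sn, i)) ∈ b.sigs ∧
      (i, (m, sn, i)) ∈ b.sigs
  let R : Finset (Fin n) := E.correct.filter fun p => ∃ k, (p, (m, sn, i)) ∈ (E.sb k p).saved
  have hiR : i ∈ R := by
    refine Finset.mem_filter.2 ⟨hi, k₀ + 1, ?_⟩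
    rw [(invoke_spec hE hk₀).1]
    exact Finset.mem_insert_self _ _
  have hcard : E.correct.card = n - E.byz.card := by simp [correct, Finset.card_compl]
  have hbyz := hE.byz_card
  obtain ⟨q, hq, hle⟩ := exists_le_card_of_forall_le_card R ⟨i, hiR⟩ rel (E.correct.card - d) <| by
    intro p hp
    obtain ⟨hpc, k, hk⟩ := Finset.mem_filter.1 hp
    obtain ⟨k', hk', b, hb, e, h1, h2⟩ := own_saved_sent hE hpc hk
    obtain ⟨r, hr⟩ := received_of_sent hE hF hk' hb
    refine (card_sub_le_card_sdiff_lost hE k' r).trans (Finset.card_le_card fun q hq => ?_)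
    obtain ⟨k'', e''⟩ := hr q hq
    have hqc := (Finset.mem_sdiff.1 hq).1
    refine Finset.mem_filter.2 ⟨Finset.mem_filter.2 ⟨hqc, k'' + 1, ?_⟩, k'', p, b, e'', e, h1, h2⟩
    have hs : (sn, i) ∈ (E.sb (k'' + 1) q).signed := by
      have prog := (sbReceive_progress (t := t) (i := q) (s := E.sb k'' q) (b := b)
        (by rw [e]; exact fresh q hqc k'') (by rw [e]; exact h2)).2.1
      rw [e] at prog
      rw [(receive_spec hE e'').1]
      exact prog
    -- `q` has signed some message for `(sn, i)`; the sender's signature saved with it shows that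
    -- this message is `m`.
    obtain ⟨m', h3, h4⟩ := saved_of_signed hE hs
    obtain rfl := uniq (unforgeable hE h4 hi)
    exact h3
  have hqc := (Finset.mem_filter.1 hq).1
  set S := R.filter fun p => rel p q
  have hS : S.Nonempty := Finset.card_pos.1 (by omega)
  have hrel : ∀ p ∈ S, rel p q := fun p hp => (Finset.mem_filter.1 hp).2
  -- `κ p` is a time at which `q` receives the signature of `p`. At the latest of these times, `q`
  -- has saved the signatures of all members of `S`.
  choose! κ hκ using hrel
  obtain ⟨p₀, hp₀, hmax⟩ := S.exists_max_image κ hS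
  obtain ⟨j, b, e, hc, -, h2⟩ := hκ p₀ hp₀
  have prog := sbReceive_progress (t := t) (i := q) (s := E.sb (κ p₀) q) (b := b)
    (by rw [hc]; exact fresh q hqc _) (by rw [hc]; exact h2)
  refine hno q hqc ⟨κ p₀, ⟨_, e⟩, ?_⟩
  rw [(receive_spec hE e).2.2, ← hc]
  refine prog.2.2.2 ?_
  rw [← (receive_spec hE e).1, hc]
  have hsub : S.image (fun p => (p, (m, sn, i))) ⊆ (E.sb (κ p₀ + 1) q).savedFor (m, sn, i) := by
    intro σ hσ
    obtain ⟨p, hp, rfl⟩ := Finset.mem_image.1 hσ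
    refine SBState.mem_savedFor.2 ⟨?_, rfl⟩
    obtain ⟨j', b', e', hc', h1', h2'⟩ := hκ p hp
    refine (sb_mono hE (Nat.succ_le_succ (hmax p hp)) q).1 ?_
    rw [Nat.succ_eq_add_one, (receive_spec hE e').1]
    exact (sbReceive_progress (t := t) (i := q) (s := E.sb (κ p) q) (b := b')
      (by rw [hc']; exact fresh q hqc _) (by rw [hc']; exact h2')).1 _ h1' hc'.symm
  have := Finset.card_le_card hsub
  rw [Finset.card_image_of_injective _ (fun p p' h => (Prod.ext_iff.1 h).1)] at this
  -- Here `2 * (c - d) ≥ 2 * (n - t - d) > n + t`, which is where `n > 3t + 2d` enters.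
  omega

end Trace

theorem sbAlgorithm_implementsMBRB {n : ℕ} {App : Type u} [DecidableEq App] {t d : ℕ}
    (hn : 3 * t + 2 * d < n) : (sbAlgorithm n App t).ImplementsMBRB t d :=
  fun _ hE => ⟨⟨Trace.sb_validity hE, Trace.sb_noDuplication hE,
    fun _ _ _ _ _ _ _ _ _ h h' => Trace.delivers_unique hE h h'⟩,
    fun hF => ⟨Trace.sb_localDelivery hn hE hF, Trace.sb_globalDelivery hE hF⟩⟩

/-! ### A fair execution with one broadcast, some processes being cut off -/

namespace Algorithm

variable {n : ℕ} {App : Type u} (A : Algorithm.{u, v} n App)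

/-- The local states, and the implementation messages broadcast so far, at each time. -/
structure Config where
  state : Fin n → A.State
  log : ℕ → Fin n × List A.Msg

variable (s : Fin n) (m : App) (act cut : Finset (Fin n))

/-- The event at a given time.  At time `0` the process `s` mbrb-broadcasts `m`; at the time
`Nat.pair k (Nat.pair r i) + 1` the process number `i` receives the message number `r` of
time `k`, or it takes a local step if its number is shifted by `n`. -/
def scheduled (c : Config A) : ℕ → Option (Fin n × Input n App A.Msg)
  | 0 => some (s, .invoke m 0)
  | k + 1 =>
    let i := k.unpair.2.unpair.2
    if h : i < n then
      if (⟨i, h⟩ : Fin n) ∈ act then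
        (c.log k.unpair.1).2[k.unpair.2.unpair.1]?.map fun msg =>
          (⟨i, h⟩, .receive (c.log k.unpair.1).1 msg)
      else none
    else if h : i - n < n then
      if (⟨i - n, h⟩ : Fin n) ∈ act ∪ cut then some (⟨i - n, h⟩, .tick) else none
    else none

/-- The configuration after an event at time `k`. -/
def Config.next {A : Algorithm.{u, v} n App} (c : Config A) (k : ℕ) :
    Option (Fin n × Input n App A.Msg) → Config A
  | none => c
  | some (i, x) =>
    { state := Function.update c.state i (A.step i (c.state i) x).1
      log := Function.update c.log k (i, (A.step i (c.state i) x).2.1) }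

/-- The configurations of the scheduled execution. -/
def config : ℕ → Config A
  -- Times without an event so far have an empty log, so nothing can be received from them; the
  -- process recorded there is a dummy.
  | 0 => ⟨A.init, fun _ => (s, [])⟩
  | k + 1 => (config k).next k (A.scheduled s m act cut (config k) k)

/-- The scheduled execution: the processes of `act` communicate faithfully, those of `cut` are
correct but receive nothing, the other ones are Byzantine and silent. -/
def scheduledTrace : Trace A where
  byz := (act ∪ cut)ᶜ
  event k := A.scheduled s m act cut (A.config s m act cut k) k
  state k := (A.config s m act cut k).state
  lost _ _ := cut
  -- This inverts the coding of receptions in `scheduled`; the shift by one is there because time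
  -- `0` is the invocation.
  origin k := ((k - 1).unpair.1, (k - 1).unpair.2.unpair.1)

variable {A s m act cut}

local notation "𝓔" => A.scheduledTrace s m act cut

lemma scheduledTrace_correct : (𝓔).correct = act ∪ cut := by
  simp [Trace.correct, scheduledTrace]

lemma scheduledTrace_event_cases {k : ℕ} {i : Fin n} {x : Input n App A.Msg}
    (h : (𝓔).event k = some (i, x)) :
    (k = 0 ∧ i = s ∧ x = .invoke m 0) ∨
    (∃ k' r msg, k = Nat.pair k' (Nat.pair r i) + 1 ∧ (𝓔).origin k = (k', r) ∧ i ∈ act ∧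
      ((A.config s m act cut k).log k').2[r]? = some msg ∧
      x = .receive ((A.config s m act cut k).log k').1 msg) ∨
    (i ∈ act ∪ cut ∧ x = .tick) := by
  cases k with
  | zero =>
    simp only [scheduledTrace, scheduled, Option.some.injEq, Prod.mk.injEq] at h
    exact .inl ⟨rfl, h.1.symm, h.2.symm⟩
  | succ k =>
    simp only [scheduledTrace, scheduled] at h
    split_ifs at h with h1 h2 h3 h4
    · obtain ⟨msg, h5, h6⟩ := Option.map_eq_some_iff.1 h
      simp only [Prod.mk.injEq] at h6
      obtain ⟨rfl, rfl⟩ := h6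
      exact .inr (.inl ⟨_, _, msg, by simp, by simp [scheduledTrace], h2, h5, rfl⟩)
    · simp only [Option.some.injEq, Prod.mk.injEq] at h
      obtain ⟨rfl, rfl⟩ := h
      exact .inr (.inr ⟨h4, rfl⟩)

/-- Whatever the log offers for reception was sent strictly earlier, which gives causality. -/
lemma scheduledTrace_log (k k' : ℕ) :
    (A.config s m act cut k).log k' = (s, []) ∨
    (k' < k ∧ ∃ i, (𝓔).ActsAt i k' ∧
      (A.config s m act cut k).log k' = (i, (𝓔).sent k')) := by
  induction k with
  | zero => exact .inl rfl
  | succ k ih =>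
    have e : A.config s m act cut (k + 1) =
      (A.config s m act cut k).next k ((𝓔).event k) := rfl
    rcases hx : (𝓔).event k with _ | ⟨i, x⟩
    · rw [e, hx]
      exact ih.imp id fun h => ⟨by omega, h.2⟩
    · rw [e, hx]
      by_cases hk : k' = k
      · subst hk
        refine .inr ⟨k'.lt_succ_self, i, ⟨x, hx⟩, ?_⟩
        simp only [Config.next, Function.update_self, Trace.sent, hx]
        rfl
      · simp only [Config.next, Function.update_of_ne hk]
        exact ih.imp id fun h => ⟨by omega, h.2⟩

lemma scheduledTrace_log_eq {k k' : ℕ} (h : k' < k) {i : Fin n} (hi : (𝓔).ActsAt i k') :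
    (A.config s m act cut k).log k' = (i, (𝓔).sent k') := by
  obtain ⟨x, hx⟩ := hi
  induction k with
  | zero => omega
  | succ k ih =>
    have e : A.config s m act cut (k + 1) =
      (A.config s m act cut k).next k ((𝓔).event k) := rfl
    by_cases hk : k' = k
    · subst hk
      rw [e, hx]
      simp only [Config.next, Function.update_self, Trace.sent, hx]
      rfl
    · rw [e]
      rcases (𝓔).event k with _ | ⟨i', x'⟩
      · exact ih (by omega)
      · simp only [Config.next, Function.update_of_ne hk]
        exact ih (by omega)

/-- The time of a reception is a function of its origin and its receiver, so no copy is received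
twice. -/
lemma scheduledTrace_receive {k : ℕ} {i j : Fin n} {msg : A.Msg}
    (h : (𝓔).event k = some (i, .receive j msg)) :
    i ∈ act ∧ k = Nat.pair ((𝓔).origin k).1 (Nat.pair ((𝓔).origin k).2 i) + 1 ∧
      ((𝓔).origin k).1 < k ∧ (𝓔).ActsAt j ((𝓔).origin k).1 ∧
      ((𝓔).sent ((𝓔).origin k).1)[((𝓔).origin k).2]? = some msg := by
  rcases scheduledTrace_event_cases h with ⟨-, -, h⟩ | ⟨k', r, msg', hk, ho, hi, hl, hx⟩ | ⟨-, h⟩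
  · cases h
  · simp only [Input.receive.injEq] at hx
    obtain ⟨rfl, rfl⟩ := hx
    rw [ho]
    refine ⟨hi, hk, ?_⟩
    rcases scheduledTrace_log (A := A) (s := s) (m := m) (act := act) (cut := cut) k k' with
      e | ⟨hlt, j, hj, e⟩
    · rw [e] at hl
      simp at hl
    · rw [e] at hl ⊢
      exact ⟨hlt, hj, hl⟩
  · cases h

lemma scheduledTrace_invoke {k : ℕ} {i : Fin n} {m' : App} {sn : ℕ}
    (h : (𝓔).event k = some (i, .invoke m' sn)) : k = 0 ∧ i = s := by
  rcases scheduledTrace_event_cases h with ⟨h, h', -⟩ | ⟨k', r, msg', -, -, -, -, hx⟩ | ⟨-, h⟩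
  · exact ⟨h, h'⟩
  · cases hx
  · cases h

lemma scheduledTrace_acts (hs : s ∈ act) {k : ℕ} {i : Fin n} (h : (𝓔).ActsAt i k) :
    i ∈ act ∪ cut := by
  obtain ⟨x, hx⟩ := h
  rcases scheduledTrace_event_cases hx with ⟨-, rfl, -⟩ | ⟨k', r, msg', -, -, h, -⟩ | ⟨h, -⟩
  · exact Finset.mem_union_left _ hs
  · exact Finset.mem_union_left _ h
  · exact h

lemma scheduledTrace_isExecution {t d : ℕ} (hs : s ∈ act) (hd : Disjoint act cut)
    (hbyz : (act ∪ cut)ᶜ.card ≤ t) (hcut : cut.card ≤ d) : (𝓔).IsExecution t d where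
  byz_card := hbyz
  event_correct k i h := by
    rw [scheduledTrace_correct]
    exact scheduledTrace_acts hs h
  state_zero i := rfl
  state_succ_acts k i x h := by
    have e : A.config s m act cut (k + 1) =
      (A.config s m act cut k).next k ((𝓔).event k) := rfl
    change (A.config s m act cut (k + 1)).state i = _
    rw [e, h]
    simp only [Config.next, Function.update_self]
    rfl
  state_succ_other k i h := by
    have e : A.config s m act cut (k + 1) =
      (A.config s m act cut k).next k ((𝓔).event k) := rfl
    change (A.config s m act cut (k + 1)).state i = _
    rw [e]
    rcases hx : (𝓔).event k with _ | ⟨i', x'⟩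
    · rfl
    · have hne : i ≠ i' := by
        rintro rfl
        exact h ⟨x', hx⟩
      simp only [Config.next, Function.update_of_ne hne]
      rfl
  invoke_once i m₁ m₂ sn k k' h h' :=
    (scheduledTrace_invoke h).1.trans (scheduledTrace_invoke h').1.symm
  lost_correct k r := by
    rw [scheduledTrace_correct]
    exact Finset.subset_union_right
  lost_card k r := hcut
  receive_correct k i j msg h _ := by
    obtain ⟨hi, -, h1, h2, h3⟩ := scheduledTrace_receive h
    exact ⟨h1, h2, h3, Finset.disjoint_left.1 hd hi⟩
  receive_once k k' i j j' msg msg' h h' _ _ ho := by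
    have h1 := (scheduledTrace_receive h).2.1
    have h2 := (scheduledTrace_receive h').2.1
    rw [ho] at h1
    exact h1.trans h2.symm
  -- The Byzantine processes are silent here.
  receive_byz k i j msg h hj := by
    have := scheduledTrace_acts hs (scheduledTrace_receive h).2.2.2.1
    exact absurd this (Finset.mem_compl.1 hj)

lemma scheduledTrace_fair : (𝓔).Fair where
  receives k r j hj hr i hi hl := by
    rw [scheduledTrace_correct] at hi
    have hi : i ∈ act := (Finset.mem_union.1 hi).resolve_right hl
    -- A pairing code is at least its first component, so after adding one the reception comes
    -- strictly after the broadcast.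
    have hlt : k < Nat.pair k (Nat.pair r i) + 1 := Nat.lt_succ_of_le (Nat.left_le_pair _ _)
    refine ⟨Nat.pair k (Nat.pair r i) + 1, ((𝓔).sent k)[r], ?_, by simp [scheduledTrace]⟩
    have e := scheduledTrace_log_eq hlt hj
    change A.scheduled s m act cut (A.config s m act cut (Nat.pair k (Nat.pair r i) + 1))
      (Nat.pair k (Nat.pair r i) + 1) = _
    simp only [scheduled, Nat.unpair_pair, Fin.is_lt, Fin.eta, hi, if_true, dif_pos, e,
      List.getElem?_eq_getElem hr, Option.map_some]
  ticks i hi k := by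
    rw [scheduledTrace_correct] at hi
    refine ⟨Nat.pair k (Nat.pair 0 (i + n)) + 1,
      (Nat.left_le_pair _ _).trans (Nat.le_succ _), ?_⟩
    simp [scheduledTrace, scheduled, Finset.mem_union.1 hi]

end Algorithm

/-! ### Reachable states and origins of signatures -/

namespace Trace

variable {n : ℕ} {App : Type u} {A : Algorithm.{u, v} n App} {t d : ℕ} {E : Trace A}

/-- `EventDriven` and `NonForging` speak of runs on input sequences; this carries them over to
executions. -/
lemma exists_run_eq_state (hE : E.IsExecution t d) (k : ℕ) (i : Fin n) :
    ∃ h, E.state k i = A.run i h ∧ ∀ x ∈ h, ∃ k' < k, E.event k' = some (i, x) := by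
  induction k with
  | zero => exact ⟨[], hE.state_zero i, by simp⟩
  | succ k ih =>
    obtain ⟨h, h1, h2⟩ := ih
    by_cases hk : E.ActsAt i k
    · obtain ⟨x, hx⟩ := hk
      refine ⟨h ++ [x], ?_, ?_⟩
      · rw [hE.state_succ_acts k i x hx, h1]
        simp [Algorithm.run]
      · intro y hy
        rcases List.mem_append.1 hy with hy | hy
        · obtain ⟨k', hk', e⟩ := h2 y hy
          exact ⟨k', by omega, e⟩
        · rw [List.mem_singleton.1 hy]
          exact ⟨k, k.lt_succ_self, hx⟩
    · refine ⟨h, (hE.state_succ_other k i hk).trans h1, fun y hy => ?_⟩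
      obtain ⟨k', hk', e⟩ := h2 y hy
      exact ⟨k', by omega, e⟩

lemma sent_tick (hA : A.EventDriven) (hE : E.IsExecution t d) {k : ℕ} {i : Fin n}
    (h : E.event k = some (i, .tick)) : E.sent k = [] := by
  obtain ⟨l, hl, -⟩ := exists_run_eq_state hE k i
  simp only [sent, h, hl]
  exact hA i l

/-- If nothing is received from Byzantine processes, every signature is first broadcast by its
signer. -/
lemma signature_origin (hA : A.NonForging) (hE : E.IsExecution t d)
    (hrec : ∀ k i j msg, E.event k = some (i, .receive j msg) → j ∈ E.correct)
    (k : ℕ) {msg : A.Msg} (hmsg : msg ∈ E.sent k) {σ : Fin n × A.Data} (hσ : σ ∈ A.sigs msg) :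
    ∃ k' ≤ k, E.ActsAt σ.1 k' ∧ ∃ msg' ∈ E.sent k', σ ∈ A.sigs msg' := by
  induction k using Nat.strong_induction_on generalizing msg with
  | _ k ih =>
    rcases hx : E.event k with _ | ⟨i, x⟩
    · have : E.sent k = [] := by simp only [sent, hx]
      simp [this] at hmsg
    · obtain ⟨l, hl, hl'⟩ := exists_run_eq_state hE k i
      have e : E.sent k = (A.step i (A.run i l) x).2.1 := by simp only [sent, hx, hl]
      rcases hA i l x msg (e ▸ hmsg) σ hσ with h | ⟨src, msg', h1, h2⟩
      · exact ⟨k, le_rfl, ⟨x, h ▸ hx⟩, msg, hmsg, hσ⟩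
      · obtain ⟨k₁, hk₁, e₁⟩ : ∃ k₁ ≤ k, E.event k₁ = some (i, .receive src msg') := by
          rcases List.mem_append.1 h1 with h1 | h1
          · obtain ⟨k₁, hk₁, e₁⟩ := hl' _ h1
            exact ⟨k₁, hk₁.le, e₁⟩
          · rw [List.mem_singleton.1 h1]
            exact ⟨k, le_rfl, hx⟩
        obtain ⟨h3, -, h4, -⟩ := hE.receive_correct _ _ _ _ e₁ (hrec _ _ _ _ e₁)
        obtain ⟨k', hk', h⟩ := ih _ (by omega) (List.mem_of_getElem? h4) h2
        exact ⟨k', by omega, h⟩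

/-! ### Interleaving two executions -/

/-- The number of the times below `k` that have parity `b`. -/
def parityCount (b : Bool) (k : ℕ) : ℕ := (k + (1 - b.toNat)) / 2

lemma parityCount_succ_self (k : ℕ) : parityCount k.bodd (k + 1) = parityCount k.bodd k + 1 := by
  have := Nat.bodd_add_div2 k
  rcases h : k.bodd <;> simp [parityCount, h] at * <;> omega

lemma parityCount_succ_of_ne {b : Bool} {k : ℕ} (h : k.bodd ≠ b) :
    parityCount b (k + 1) = parityCount b k := by
  have := Nat.bodd_add_div2 k
  rcases h' : k.bodd <;> cases b <;> simp [parityCount, h'] at * <;> omega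

lemma parityCount_self (k : ℕ) : parityCount k.bodd k = k.div2 := by
  have := Nat.bodd_add_div2 k
  rcases h : k.bodd <;> simp [parityCount, h] at * <;> omega

lemma bit_bodd_lt {k k' : ℕ} (h : k' < k.div2) : Nat.bit k.bodd k' < k := by
  have := Nat.bodd_add_div2 k
  rcases h' : k.bodd <;> simp [Nat.bit, h'] at * <;> omega

/-- The steps that the processes of `S false` take in the execution `E false`, interleaved with
those that the processes of `S true` take in the execution `E true`; the processes of `Z` are
Byzantine, and all messages between the two sides are still in transit. -/
def interleave (E : Bool → Trace A) (S : Bool → Finset (Fin n)) (Z : Finset (Fin n)) :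
    Trace A where
  byz := Z
  event k := ((E k.bodd).event k.div2).filter fun p => p.1 ∈ S k.bodd
  state k i := if i ∈ S false then (E false).state (parityCount false k) i
    else if i ∈ S true then (E true).state (parityCount true k) i else A.init i
  -- No suppression is needed: only safety is drawn from this execution, which need not be fair, so
  -- copies may stay in transit forever.
  lost _ _ := ∅
  origin k := (Nat.bit k.bodd ((E k.bodd).origin k.div2).1, ((E k.bodd).origin k.div2).2)

section Interleave

variable {E : Bool → Trace A} {S : Bool → Finset (Fin n)} {Z : Finset (Fin n)}

lemma interleave_event {k : ℕ} {i : Fin n} {x : Input n App A.Msg} :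
    (interleave E S Z).event k = some (i, x) ↔
      (E k.bodd).event k.div2 = some (i, x) ∧ i ∈ S k.bodd := by
  simp [interleave, Option.filter_eq_some_iff]

lemma interleave_state (hS : Disjoint (S false) (S true)) {b : Bool} {i : Fin n} (hi : i ∈ S b)
    (k : ℕ) : (interleave E S Z).state k i = (E b).state (parityCount b k) i := by
  cases b with
  | false => simp [interleave, hi]
  | true => simp [interleave, hi, Finset.disjoint_right.1 hS hi]

lemma interleave_sent (hS : Disjoint (S false) (S true)) {k : ℕ} {i : Fin n}
    (h : (interleave E S Z).ActsAt i k) :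
    (interleave E S Z).sent k = (E k.bodd).sent k.div2 ∧
      (interleave E S Z).delivered k = (E k.bodd).delivered k.div2 := by
  obtain ⟨x, hx⟩ := h
  have h1 := interleave_event.1 hx
  have h2 := interleave_state (E := E) (Z := Z) hS h1.2 k
  rw [parityCount_self] at h2
  simp only [sent, delivered, hx, h1.1, h2, and_self]

lemma interleave_actsAt {b : Bool} {k : ℕ} {i : Fin n} (hi : i ∈ S b) (h : (E b).ActsAt i k) :
    (interleave E S Z).ActsAt i (Nat.bit b k) := by
  obtain ⟨x, hx⟩ := h
  exact ⟨x, interleave_event.2 (by simp [hx, hi])⟩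

lemma interleave_delivers (hS : Disjoint (S false) (S true)) {b : Bool} {i j : Fin n} {m : App}
    {sn : ℕ} (hi : i ∈ S b) (h : (E b).Delivers i m sn j) :
    (interleave E S Z).Delivers i m sn j := by
  obtain ⟨k, hk, h⟩ := h
  have := interleave_actsAt (Z := Z) hi hk
  refine ⟨_, this, ?_⟩
  rw [(interleave_sent hS this).2]
  simpa using h

/-- The hypotheses make each side self-contained: what it receives comes from itself or from `Z`.
The processes of `Z` may repeat what they send in `E b`, since every signature occurring there by a
process outside `Z` was broadcast earlier by its signer, whose steps on side `b` are kept. -/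
lemma interleave_isExecution (hE : ∀ b, (E b).IsExecution t d) (hZ : Z.card ≤ t)
    (hS : Disjoint (S false) (S true)) (hSZ : ∀ b, Disjoint (S b) Z)
    (hinv : ∀ b k i m sn, (E b).event k = some (i, .invoke m sn) → i ∉ S b)
    (hrec : ∀ b k i j msg, (E b).event k = some (i, .receive j msg) → i ∈ S b → j ∉ Z →
      j ∈ S b ∧ j ∈ (E b).correct)
    (hsig : ∀ b k i j msg, (E b).event k = some (i, .receive j msg) → i ∈ S b → j ∈ Z →
      ∀ σ ∈ A.sigs msg, σ.1 ∉ Z → σ.1 ∈ S b ∧ ∃ k' < k, (E b).ActsAt σ.1 k' ∧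
        ∃ msg' ∈ (E b).sent k', σ ∈ A.sigs msg') :
    (interleave E S Z).IsExecution t d where
  byz_card := hZ
  event_correct k i h := by
    obtain ⟨x, hx⟩ := h
    exact mem_correct.2 (Finset.disjoint_left.1 (hSZ _) (interleave_event.1 hx).2)
  state_zero i := by
    simp [interleave, parityCount, (hE _).state_zero]
  state_succ_acts k i x h := by
    have h1 := interleave_event.1 h
    rw [interleave_state hS h1.2, interleave_state hS h1.2, parityCount_succ_self,
      parityCount_self]
    exact (hE _).state_succ_acts _ _ _ h1.1
  state_succ_other k i h := by
    by_cases hi : ∃ b, i ∈ S b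
    · obtain ⟨b, hi⟩ := hi
      rw [interleave_state hS hi, interleave_state hS hi]
      by_cases hb : k.bodd = b
      · subst hb
        rw [parityCount_succ_self, parityCount_self]
        refine (hE _).state_succ_other _ _ fun ⟨x, hx⟩ => h ⟨x, interleave_event.2 ⟨hx, hi⟩⟩
      · rw [parityCount_succ_of_ne hb]
    · push Not at hi
      simp [interleave, hi]
  invoke_once i m m' sn k k' h _ :=
    absurd (interleave_event.1 h).2 (hinv _ _ _ _ _ (interleave_event.1 h).1)
  lost_correct k r := Finset.empty_subset _
  lost_card k r := by simp [interleave]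
  receive_correct k i j msg h hj := by
    obtain ⟨h1, hi⟩ := interleave_event.1 h
    obtain ⟨hjS, hjc⟩ := hrec _ _ _ _ _ h1 hi (mem_correct.1 hj)
    obtain ⟨h2, h3, h4, -⟩ := (hE _).receive_correct _ _ _ _ h1 hjc
    have h5 := interleave_actsAt (Z := Z) hjS h3
    refine ⟨?_, h5, ?_, by simp [interleave]⟩
    · change Nat.bit k.bodd _ < k
      exact bit_bodd_lt h2
    · change ((interleave E S Z).sent (Nat.bit k.bodd _))[_]? = _
      rw [(interleave_sent hS h5).1, Nat.bodd_bit, Nat.div2_bit]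
      exact h4
  receive_once k k' i j j' msg msg' h h' hj hj' ho := by
    obtain ⟨h1, hi⟩ := interleave_event.1 h
    obtain ⟨h1', hi'⟩ := interleave_event.1 h'
    have hjc := (hrec _ _ _ _ _ h1 hi (mem_correct.1 hj)).2
    have hjc' := (hrec _ _ _ _ _ h1' hi' (mem_correct.1 hj')).2
    simp only [interleave, Prod.mk.injEq] at ho
    have hb : k.bodd = k'.bodd := by simpa using congrArg Nat.bodd ho.1
    have hd : ((E k.bodd).origin k.div2).1 = ((E k'.bodd).origin k'.div2).1 := by
      simpa using congrArg Nat.div2 ho.1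
    rw [← hb] at h1' hjc' hd ho
    have := (hE _).receive_once _ _ _ _ _ _ _ h1 h1' hjc hjc' (Prod.ext hd ho.2)
    rw [← Nat.bit_bodd_div2 k, ← Nat.bit_bodd_div2 k', hb, this]
  receive_byz k i j msg h hj σ hσ hc := by
    obtain ⟨h1, hi⟩ := interleave_event.1 h
    obtain ⟨h2, k', hk', h3, msg', h4, h5⟩ :=
      hsig _ _ _ _ _ h1 hi hj σ hσ (mem_correct.1 hc)
    have h6 := interleave_actsAt (Z := Z) h2 h3
    refine ⟨Nat.bit k.bodd k', bit_bodd_lt hk', msg', ?_, h5⟩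
    rw [(interleave_sent hS h6).1, Nat.bodd_bit, Nat.div2_bit]
    exact h4

end Interleave

end Trace

/-! ### Necessity -/

section Necessity

open Algorithm

variable {n : ℕ} {App : Type u} {A : Algorithm.{u, v} n App} {t d : ℕ}

/-- A process that is cut off does not mbrb-deliver. -/
lemma not_delivers_of_mem_cut (hA : A.ImplementsMBRB t d) {s p : Fin n} {m : App}
    {act cut : Finset (Fin n)} (hs : s ∈ act) (hd : Disjoint act cut)
    (hE : (A.scheduledTrace s m act cut).IsExecution t d) (hp : p ∈ cut) {sn : ℕ} :
    ¬ (A.scheduledTrace s m act cut).Delivers p m sn s := by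
  intro hdel
  have hpa : p ∉ act := Finset.disjoint_right.1 hd hp
  -- Keep only the steps of `p`, which are local ones, and let every process be correct: `p` would
  -- then deliver a message that its correct sender never broadcast, against validity.
  let S : Bool → Finset (Fin n) := fun b => if b then ∅ else {p}
  have hS : Disjoint (S false) (S true) := by simp [S]
  have mem : ∀ {b i}, i ∈ S b → i = p := by
    intro b i h
    cases b
    · simpa [S] using h
    · simp [S] at h
  have hG := Trace.interleave_isExecution (E := fun _ => A.scheduledTrace s m act cut) (S := S)
    (Z := ∅) (fun _ => hE) (by simp) hS (by simp)
    (fun b k i m' sn' h hi => by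
      have := (scheduledTrace_invoke h).2
      rw [mem hi] at this
      exact hpa (this ▸ hs))
    (fun b k i j msg h hi => by
      have := (scheduledTrace_receive h).1
      rw [mem hi] at this
      exact absurd this hpa)
    (fun b k i j msg h hi hj => by simp at hj)
  obtain ⟨k, hk⟩ := (hA _ hG).1.1 p (by simp [Trace.mem_correct, Trace.interleave]) s
    (by simp [Trace.mem_correct, Trace.interleave]) m sn
    (Trace.interleave_delivers hS (b := false) (by simp [S]) hdel)
  have := mem (Trace.interleave_event.1 hk).2
  exact hpa (this ▸ hs)

/-- In the scheduled execution, more processes mbrb-deliver than those of a small set `B`. -/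
lemma exists_delivers_notMem (hA : A.ImplementsMBRB t d) {s : Fin n} {m : App}
    {act cut B : Finset (Fin n)} (hs : s ∈ act) (hd : Disjoint act cut)
    (hE : (A.scheduledTrace s m act cut).IsExecution t d)
    (hB : (act ∪ cut)ᶜ.card + d + B.card < n) :
    ∃ p ∈ act, p ∉ B ∧ (A.scheduledTrace s m act cut).Delivers p m 0 s := by
  set E := A.scheduledTrace s m act cut
  have hc : E.correct = act ∪ cut := scheduledTrace_correct
  obtain ⟨hloc, hglob⟩ := (hA E hE).2 scheduledTrace_fair
  have hsc : s ∈ E.correct := by rw [hc]; exact Finset.mem_union_left _ hs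
  obtain ⟨j, hj, hdel⟩ := hloc s hsc m 0 ⟨0, rfl⟩
  -- At least `c - d > |B|` correct processes deliver, and none of them is cut off.
  have hle := hglob j hj m 0 s hdel
  by_contra! hno
  have hsub : {i' : Fin n | i' ∈ E.correct ∧ E.Delivers i' m 0 s} ⊆ (B : Set (Fin n)) := by
    rintro p ⟨hp, hdel⟩
    by_contra hpB
    rw [hc] at hp
    rcases Finset.mem_union.1 hp with hp | hp
    · exact hno p hp hpB hdel
    · exact not_delivers_of_mem_cut hA hs hd hE hp hdel
  have h1 := Set.ncard_le_ncard hsub (Set.toFinite _)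
  rw [Set.ncard_coe_finset] at h1
  have h2 : (act ∪ cut).card = n - (act ∪ cut)ᶜ.card := by
    have := Finset.card_add_card_compl (act ∪ cut)
    simp only [Fintype.card_fin] at this
    omega
  have h3 := congrArg Finset.card hc
  omega

/-- The partition argument.  The class `none` is Byzantine and equivocates; `some (u, b)` is on the
side `b`, and in the view of the other side it is Byzantine and silent if `u = false`, cut off
if `u = true`. -/
lemma false_of_partition (hm : Nontrivial App) (hED : A.EventDriven) (hNF : A.NonForging)
    (hA : A.ImplementsMBRB t d) (l : Fin n → Option (Bool × Bool)) {s : Fin n} (hs : l s = none)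
    (hB : (Finset.univ.filter fun i => l i = none).card ≤ t)
    (hQ : ∀ b, (Finset.univ.filter fun i => l i = some (false, b)).card ≤ t)
    (hD : ∀ b, (Finset.univ.filter fun i => l i = some (true, b)).card ≤ d)
    (hn : ∀ b, (Finset.univ.filter fun i => l i = some (false, b)).card + d +
      (Finset.univ.filter fun i => l i = none).card < n) : False := by
  obtain ⟨m₀, m₁, hne⟩ := exists_pair_ne App
  let m : Bool → App := fun b => if b then m₁ else m₀
  let B : Finset (Fin n) := Finset.univ.filter fun i => l i = none
  let S : Bool → Finset (Fin n) := fun b =>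
    Finset.univ.filter fun i => l i = some (false, b) ∨ l i = some (true, b)
  let act : Bool → Finset (Fin n) := fun b => B ∪ S b
  let cut : Bool → Finset (Fin n) := fun b => Finset.univ.filter fun i => l i = some (true, !b)
  have hact : ∀ {b i}, i ∈ act b ↔ l i = none ∨ l i = some (false, b) ∨ l i = some (true, b) := by
    simp [act, B, S]
  have hS' : ∀ {b i}, i ∈ S b ↔ l i = some (false, b) ∨ l i = some (true, b) := by
    simp [S]
  have hcut : ∀ {b i}, i ∈ cut b ↔ l i = some (true, !b) := by simp [cut]
  have hB' : ∀ {i}, i ∈ B ↔ l i = none := by simp [B]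
  have hsa : ∀ b, s ∈ act b := fun b => hact.2 (.inl hs)
  have hdis : ∀ b, Disjoint (act b) (cut b) := fun b => Finset.disjoint_left.2 fun i h h' => by
    rw [hact] at h
    rw [hcut] at h'
    cases b <;> simp_all
  have hcompl : ∀ b, (act b ∪ cut b)ᶜ = Finset.univ.filter fun i => l i = some (false, !b) := by
    intro b
    ext i
    simp only [Finset.mem_compl, Finset.mem_union, hact, hcut, Finset.mem_filter,
      Finset.mem_univ, true_and]
    rcases l i with _ | ⟨u, b'⟩ <;> cases b <;> simp <;> cases u <;> cases b' <;> simp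
  let E : Bool → Trace A := fun b => A.scheduledTrace s (m b) (act b) (cut b)
  have hE : ∀ b, (E b).IsExecution t d := fun b =>
    scheduledTrace_isExecution (hsa b) (hdis b) (by rw [hcompl]; exact hQ _) (hD _)
  have hS : Disjoint (S false) (S true) := Finset.disjoint_left.2 fun i h h' => by
    rw [hS'] at h h'
    rcases h with h | h <;> simp [h] at h'
  have hSB : ∀ b, Disjoint (S b) B := fun b => Finset.disjoint_left.2 fun i h h' => by
    rw [hS'] at h
    rw [hB'] at h'
    simp [h'] at h
  -- This is where event-drivenness matters: a cut-off process takes only local steps, hence sends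
  -- nothing to the other side.
  have sender : ∀ {b k j msg}, (E b).ActsAt j k → msg ∈ (E b).sent k → j ∈ act b := by
    rintro b k j msg ⟨x, hx⟩ hmsg
    rcases scheduledTrace_event_cases hx with ⟨-, rfl, -⟩ | ⟨k', r, msg', -, -, h, -⟩ | ⟨-, rfl⟩
    · exact hsa b
    · exact h
    · rw [Trace.sent_tick hED (hE b) hx] at hmsg
      simp at hmsg
  have side : ∀ {b i}, i ∈ act b → i ∉ B → i ∈ S b := fun h h' =>
    (Finset.mem_union.1 h).resolve_left h'
  have hcorr : ∀ {b i}, i ∈ act b → i ∈ (E b).correct := fun h => by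
    rw [scheduledTrace_correct]
    exact Finset.mem_union_left _ h
  have hrec : ∀ {b k i j msg}, (E b).event k = some (i, .receive j msg) → j ∈ act b :=
    fun h => sender (scheduledTrace_receive h).2.2.2.1
      (List.mem_of_getElem? (scheduledTrace_receive h).2.2.2.2)
  have hG := Trace.interleave_isExecution (E := E) (S := S) (Z := B) hE hB hS hSB
    (fun b k i m' sn h hi => by
      rw [(scheduledTrace_invoke h).2] at hi
      exact Finset.disjoint_left.1 (hSB b) hi (hB'.2 hs))
    (fun b k i j msg h hi hj => ⟨side (hrec h) hj, hcorr (hrec h)⟩)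
    -- Nothing is received from Byzantine processes in `E b`, so each signature was first broadcast
    -- by its signer; being active and outside `B`, that signer is on side `b`.
    (fun b k i j msg h hi hj σ hσ hc => by
      obtain ⟨-, -, h1, -, h3⟩ := scheduledTrace_receive h
      obtain ⟨k', hk', h4, msg', h5, h6⟩ := Trace.signature_origin hNF (hE b)
        (fun _ _ _ _ h => hcorr (hrec h)) _ (List.mem_of_getElem? h3) hσ
      exact ⟨side (sender h4 h5) hc, k', by omega, h4, msg', h5, h6⟩)
  have hdel : ∀ b, ∃ p ∈ S b, (E b).Delivers p (m b) 0 s := fun b => by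
    obtain ⟨p, hp, hpB, h⟩ := exists_delivers_notMem (B := B) hA (hsa b) (hdis b) (hE b)
      (by rw [hcompl]; exact hn _)
    exact ⟨p, side hp hpB, h⟩
  obtain ⟨p, hp, h⟩ := hdel false
  obtain ⟨q, hq, h'⟩ := hdel true
  have hpq : p ≠ q := by
    rintro rfl
    exact Finset.disjoint_left.1 hS hp hq
  exact hne ((hA _ hG).1.2.2 p (Trace.mem_correct.2 (Finset.disjoint_left.1 (hSB _) hp)) q
    (Trace.mem_correct.2 (Finset.disjoint_left.1 (hSB _) hq)) hpq s 0 _ _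
    (Trace.interleave_delivers hS hp h) (Trace.interleave_delivers hS hq h'))

/-! ### The sizes of the classes. -/

lemma card_filter_le_of_imp_mem_Ico {P : Fin n → Prop} [DecidablePred P] {a b c : ℕ}
    (h : ∀ i, P i → a ≤ i.val ∧ i.val < b) (hc : b ≤ a + c) :
    (Finset.univ.filter P).card ≤ c := by
  have : (Finset.univ.filter P).card ≤ (Finset.Ico a b).card := by
    refine Finset.card_le_card_of_injOn Fin.val (fun i hi => ?_) (fun i _ j _ e => Fin.ext e)
    have := h i (Finset.mem_filter.1 hi).2
    exact Finset.mem_coe.2 (Finset.mem_Ico.2 this)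
  rw [Nat.card_Ico] at this
  omega

theorem lt_of_implementsMBRB (hm : Nontrivial App) (ht : 1 ≤ t) (hn3 : 3 ≤ n) (htd : t + d < n)
    (hED : A.EventDriven) (hNF : A.NonForging) (hA : A.ImplementsMBRB t d) :
    3 * t + 2 * d < n := by
  by_contra! hle
  obtain ⟨β, q₀, q₁, d₀, d₁, hsum, hβ, hβt, hq₀, hq₁, hd₀, hd₁, hn₀, hn₁⟩ :
      ∃ β q₀ q₁ d₀ d₁ : ℕ, β + q₀ + q₁ + d₀ + d₁ = n ∧ 1 ≤ β ∧ β ≤ t ∧ q₀ ≤ t ∧ q₁ ≤ t ∧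
        d₀ ≤ d ∧ d₁ ≤ d ∧ q₀ + d + β < n ∧ q₁ + d + β < n := by
    -- If the message adversary is strong, a single Byzantine sender suffices and the two cut-off
    -- classes share the rest. Otherwise these classes have `d` members each and the remaining `n -
    -- 2d ≤ 3t` processes are split into three nearly equal parts; for `d = 0` the strict
    -- inequalities need the third part to be nonempty, which is the role of `3 ≤ n`.
    by_cases h : n - 1 ≤ 2 * d
    · exact ⟨1, 0, 0, (n - 1) / 2, n - 1 - (n - 1) / 2, by omega, by omega, by omega, by omega,
        by omega, by omega, by omega, by omega, by omega⟩
    · exact ⟨(n - 2 * d + 2) / 3, (n - 2 * d + 1) / 3, (n - 2 * d) / 3, d, d, by omega, by omega,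
        by omega, by omega, by omega, by omega, by omega, by omega, by omega⟩
  let l : Fin n → Option (Bool × Bool) := fun i =>
    if i.val < β then none
    else if i.val < β + q₀ then some (false, false)
    else if i.val < β + q₀ + q₁ then some (false, true)
    else if i.val < β + q₀ + q₁ + d₀ then some (true, false)
    else some (true, true)
  have hB : (Finset.univ.filter fun i => l i = none).card ≤ β := by
    refine card_filter_le_of_imp_mem_Ico (a := 0) (b := β) (fun i hi => ?_) (by omega)
    simp only [l] at hi
    split_ifs at hi <;> simp at hi <;> omega
  have hQ₀ : (Finset.univ.filter fun i => l i = some (false, false)).card ≤ q₀ := by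
    refine card_filter_le_of_imp_mem_Ico (a := β) (b := β + q₀) (fun i hi => ?_) (by omega)
    simp only [l] at hi
    split_ifs at hi <;> simp at hi <;> omega
  have hQ₁ : (Finset.univ.filter fun i => l i = some (false, true)).card ≤ q₁ := by
    refine card_filter_le_of_imp_mem_Ico (a := β + q₀) (b := β + q₀ + q₁)
      (fun i hi => ?_) (by omega)
    simp only [l] at hi
    split_ifs at hi <;> simp at hi <;> omega
  have hD₀ : (Finset.univ.filter fun i => l i = some (true, false)).card ≤ d₀ := by
    refine card_filter_le_of_imp_mem_Ico (a := β + q₀ + q₁) (b := β + q₀ + q₁ + d₀)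
      (fun i hi => ?_) (by omega)
    simp only [l] at hi
    split_ifs at hi <;> simp at hi <;> omega
  have hD₁ : (Finset.univ.filter fun i => l i = some (true, true)).card ≤ d₁ := by
    refine card_filter_le_of_imp_mem_Ico (a := β + q₀ + q₁ + d₀) (b := n)
      (fun i hi => ?_) (by omega)
    simp only [l] at hi
    split_ifs at hi <;> simp at hi <;> omega
  refine false_of_partition hm hED hNF hA l (s := ⟨0, by omega⟩) (if_pos hβ)
    (by omega) ?_ ?_ ?_ <;> rintro (_ | _) <;> omega

end Necessity

end MBRB

theorem theorem3 {App : Type u} [DecidableEq App] (n t d : ℕ) :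
    -- sufficiency, by the signature-based algorithm
    (3 * t + 2 * d < n →
      (MBRB.sbAlgorithm n App t).EventDriven ∧ (MBRB.sbAlgorithm n App t).NonForging ∧
        (MBRB.sbAlgorithm n App t).ImplementsMBRB t d) ∧
    -- necessity, and optimality of the signature-based algorithm
    (Nontrivial App → 1 ≤ t → 3 ≤ n → t + d < n →
      ∀ A : MBRB.Algorithm.{u, v} n App, A.EventDriven → A.NonForging → A.ImplementsMBRB t d →
        3 * t + 2 * d < n ∧ (MBRB.sbAlgorithm n App t).ImplementsMBRB t d) :=
  ⟨fun hn => ⟨MBRB.sbAlgorithm_eventDriven n App t, MBRB.sbAlgorithm_nonForging n App t,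
      MBRB.sbAlgorithm_implementsMBRB hn⟩,
    fun hm ht hn htd _ hED hNF hA =>
      have hlt := MBRB.lt_of_implementsMBRB hm ht hn htd hED hNF hA
      ⟨hlt, MBRB.sbAlgorithm_implementsMBRB hlt⟩⟩
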